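/- **Theorem.** (1) Let $F$ be a field of characteristic $2$ and let $Q\ge 2$ be a power of $2$. Call a matrix $M=(m_{i,j})_{0\le i,j<Q}$ over $F$ a *special $Q$-matrix* if $m_{i,j}=0$ whenever $i=j$ or $i\not\equiv j \pmod 3$, while for $i\equiv j\pmod 3$, $i\ne j$, the entry $m_{i,j}$ is nonzero and depends only on $\operatorname{ord}_2(i-j)$. Let $C(Q)=(1,\dots,1)$ and $B(Q)=(b_0,\dots,b_{Q-1})$ with $b_i=1$ if $i\equiv 2Q-1\pmod 3$ and $b_i=0$ otherwise. If $M$ is a special $Q$-matrix, then the $(Q+2)\times Q$ matrix $\begin{pmatrix}M\\ B(Q)\\ C(Q)\end{pmatrix}$ has rank $Q$. (2) Let $K$ be an algebraic closure of $\mathbb Z/2$, let $A\in K$, $A\neq 0$, write $A=\beta^2+\beta$ with $\beta\in K$, let $m$ be the degree of $\beta$ over $\mathbb Z/2$, and let $Q=2^{m-1}$. In $K[x,y,z]$ put $$P=z^4+xyz^2+x^3z+y^3z,\qquad g=g_A=P+Ax^2y^2,\qquad f=y^3z^3,$$ and let $R$ be the sum of all monomials $x^iy^jz^k$ with $k\in\{1,2\}$,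 $i+j+k=4Q$ and $i\equiv j\pmod 3$. Let $O=K[x,y,z]/(x^{4Q},y^{4Q},z^{4Q})$, graded by degree with components $O_n$, and let $s\in O_{6Q+2}$ be the class of $xyf^Q$. Define the following subspaces of $O$: * $W$ is spanned by the $x^ay^bP^k$ with $a+b+4k=6Q-5$, $k\le Q-1$, and $W_0\subseteq W$ by those with $k<Q-1$; * $W'$ is spanned by the $x^iy^jR$ with $i+j=2Q-1$ and the $x^ay^bP^k$ with $a+b+4k=6Q-1$, $k\le Q-1$. For $0\le r\le 2Q-1$ let $E_r\in W/W_0$ be the class of $x^ry^{2Q-1-r}P^{Q-1}$ and $F_r\in W'/gW_0$ the class of $x^{2Q+r}y^{4Q-1-r}$. Let $X\subseteq W/W_0$ be spanned by the $E_{2i}+E_{2Q-1-2i}$, $0\le i\le Q-1$, and let $Y\subseteq W'/gW_0$ be spanned by the $F_{2i}+F_{2Q-1-2i}$, $0\le i\le Q-1$, and the class of $(x^{2Q-2}y+xy^{2Q-2})R$. Then $u\mapsto(ug,us)$ induces a well-defined linear map $X\to Y\oplus O_{12Q-3}$, and this map is injective. Moreover $s\notin gO$, and $xy\cdot f^Q\notin(x^{4Q},y^{4Q},z^{4Q},g_A)$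 in $K[x,y,z]$. -/

import Mathlib

noncomputable section

namespace BrennerMonsky

/-! ### Special matrices -/

/-- A `Q × Q` matrix `M = (m i j)`, `0 ≤ i, j < Q`, is a special `Q`-matrix if
(1) `m i j = 0` whenever `i = j` or `i ≢ j` mod `3`, and
(2) for `i ≡ j` mod `3` and `i ≠ j`, the entry `m i j` is nonzero and depends only on the
2-adic order of the integer `i - j`. -/
structure IsSpecialMatrix {F : Type*} [Field F] {Q : ℕ} (M : Matrix (Fin Q) (Fin Q) F) :
    Prop where
  eq_zero : ∀ i j : Fin Q, (i = j ∨ ¬ (i : ℕ) ≡ j [MOD 3]) → M i j = 0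
  ne_zero : ∀ i j : Fin Q, (i : ℕ) ≡ j [MOD 3] → i ≠ j → M i j ≠ 0
  eq_of_ord_eq : ∀ i j k l : Fin Q,
    (i : ℕ) ≡ j [MOD 3] → i ≠ j → (k : ℕ) ≡ l [MOD 3] → k ≠ l →
    padicValInt 2 ((i : ℤ) - (j : ℤ)) = padicValInt 2 ((k : ℤ) - (l : ℤ)) → M i j = M k l

/-- The row vector `B(Q)`: the `i`-th entry is `1` if `i ≡ 2Q - 1` mod `3`, and `0` otherwise. -/
def rowB (F : Type*) [Field F] (Q : ℕ) : Fin Q → F :=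
  fun i => if (i : ℕ) ≡ 2 * Q - 1 [MOD 3] then 1 else 0

/-- The row vector `C(Q)`: all entries are `1`. -/
def rowC (F : Type*) [Field F] (Q : ℕ) : Fin Q → F := fun _ => 1

/-- The `(Q + 2) × Q` matrix with `M` on top, then the row `B(Q)`, then the row `C(Q)`. -/
def stacked {F : Type*} [Field F] {Q : ℕ} (M : Matrix (Fin Q) (Fin Q) F) :
    Matrix (Fin Q ⊕ Fin 2) (Fin Q) F :=
  Matrix.fromRows M (Matrix.of ![rowB F Q, rowC F Q])

/-! ### The polynomials -/

section Polynomials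

variable (K : Type*) [Field K]

/-- The polynomial ring `K[x, y, z]`. -/
abbrev Poly : Type _ := MvPolynomial (Fin 3) K

/-- The variable `x`. -/
def px : Poly K := MvPolynomial.X 0

/-- The variable `y`. -/
def py : Poly K := MvPolynomial.X 1

/-- The variable `z`. -/
def pz : Poly K := MvPolynomial.X 2

/-- `P = z⁴ + x y z² + x³ z + y³ z`. -/
def pP : Poly K := pz K ^ 4 + px K * py K * pz K ^ 2 + px K ^ 3 * pz K + py K ^ 3 * pz K

/-- `f = y³ z³`. -/
def pf : Poly K := py K ^ 3 * pz K ^ 3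

variable {K} in
/-- `g_A = P + A x² y²`. -/
def pg (A : K) : Poly K := pP K + MvPolynomial.C A * px K ^ 2 * py K ^ 2

/-- The polynomial `R`: the sum of all `x ^ i * y ^ j * z ^ k` with `k = 1` or `k = 2`,
`i + j + k = 4Q` and `i ≡ j` mod `3`. -/
def pR (Q : ℕ) : Poly K :=
  ∑ t ∈ (Finset.range (4 * Q + 1) ×ˢ Finset.range (4 * Q + 1) ×ˢ ({1, 2} : Finset ℕ)).filter
      (fun t => t.1 + t.2.1 + t.2.2 = 4 * Q ∧ t.1 ≡ t.2.1 [MOD 3]),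
    px K ^ t.1 * py K ^ t.2.1 * pz K ^ t.2.2

end Polynomials

/-! ### The graded ring `K[x, y, z] / (x^{4Q}, y^{4Q}, z^{4Q})` and its subquotients -/

section Ring

variable (K : Type*) [Field K] (Q : ℕ)

/-- The ring `O = K[x, y, z] / (x^{4Q}, y^{4Q}, z^{4Q})`. -/
abbrev O : Type _ :=
  Poly K ⧸ (Ideal.span {px K ^ (4 * Q), py K ^ (4 * Q), pz K ^ (4 * Q)} : Ideal (Poly K))

/-- The quotient map `K[x, y, z] → O`. -/
abbrev toO : Poly K →ₐ[K] O K Q := Ideal.Quotient.mkₐ K _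

/-- The homogeneous component `O_n` of degree `n`. -/
def component (n : ℕ) : Submodule K (O K Q) :=
  (MvPolynomial.homogeneousSubmodule (Fin 3) K n).map (toO K Q).toLinearMap

/-- The element of `O` represented by `x y f^Q = (x y) (y z)^{3Q}`. -/
def elemS : O K Q := toO K Q (px K * py K * pf K ^ Q)

/-- `W` is spanned by the `x^r y^s P^k` with `r + s + 4k = 6Q - 5` and `k ≤ Q - 1`. -/
def W : Submodule K (O K Q) :=
  Submodule.span K {u | ∃ r s k : ℕ, r + s + 4 * k = 6 * Q - 5 ∧ k ≤ Q - 1 ∧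
    u = toO K Q (px K ^ r * py K ^ s * pP K ^ k)}

/-- `W₀` is spanned by the `x^r y^s P^k` with `r + s + 4k = 6Q - 5` and `k < Q - 1`. -/
def W₀ : Submodule K (O K Q) :=
  Submodule.span K {u | ∃ r s k : ℕ, r + s + 4 * k = 6 * Q - 5 ∧ k < Q - 1 ∧
    u = toO K Q (px K ^ r * py K ^ s * pP K ^ k)}

/-- `Δ` is spanned by the `x^i y^j R` with `i + j = 2Q - 1`. -/
def Δ : Submodule K (O K Q) :=
  Submodule.span K {u | ∃ i j : ℕ, i + j = 2 * Q - 1 ∧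
    u = toO K Q (px K ^ i * py K ^ j * pR K Q)}

/-- `W'` is spanned by `Δ` and the `x^r y^s P^k` with `r + s + 4k = 6Q - 1` and `k ≤ Q - 1`. -/
def W' : Submodule K (O K Q) :=
  Δ K Q ⊔ Submodule.span K {u | ∃ r s k : ℕ, r + s + 4 * k = 6 * Q - 1 ∧ k ≤ Q - 1 ∧
    u = toO K Q (px K ^ r * py K ^ s * pP K ^ k)}

variable {K} in
/-- `g W₀`, where `g = g_A`. -/
def gW₀ (A : K) : Submodule K (O K Q) :=
  (W₀ K Q).map (LinearMap.mulLeft K (toO K Q (pg A)))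

/-- The quotient space `W / W₀`. -/
abbrev WQuot : Type _ := W K Q ⧸ (W₀ K Q).submoduleOf (W K Q)

variable {K} in
/-- The quotient space `W' / g W₀`. -/
abbrev W'Quot (A : K) : Type _ := W' K Q ⧸ (gW₀ Q A).submoduleOf (W' K Q)

variable {K Q} in
/-- The class in `W / W₀` of an element of `W`. -/
abbrev classW (u : W K Q) : WQuot K Q := Submodule.Quotient.mk u

variable {K Q} in
/-- The class in `W' / g W₀` of an element of `W'`. -/
abbrev classW' (A : K) (v : W' K Q) : W'Quot Q A := Submodule.Quotient.mk v

/-- `E_r` is the class of `x^r y^s P^{Q-1}` in `W / W₀`, where `r + s = 2Q - 1`. -/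
def E (r : Fin (2 * Q)) : WQuot K Q :=
  classW ⟨toO K Q (px K ^ (r : ℕ) * py K ^ (2 * Q - 1 - r) * pP K ^ (Q - 1)),
    Submodule.subset_span ⟨r, 2 * Q - 1 - r, Q - 1, by have := r.2; omega, le_rfl, rfl⟩⟩

variable {K} in
/-- `F_r` is the class of `x^{2Q+r} y^{2Q+s}` in `W' / g W₀`, where `r + s = 2Q - 1`. -/
def F (A : K) (r : Fin (2 * Q)) : W'Quot Q A :=
  classW' A ⟨toO K Q (px K ^ (2 * Q + r) * py K ^ (2 * Q + (2 * Q - 1 - r))),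
    Submodule.mem_sup_right (Submodule.subset_span
      ⟨2 * Q + r, 2 * Q + (2 * Q - 1 - r), 0, by have := r.2; omega, Nat.zero_le _, by simp⟩)⟩

/-- `G_i = E_{2i} + E_{2Q-1-2i}`, for `0 ≤ i ≤ Q - 1`. -/
def G (i : Fin Q) : WQuot K Q :=
  E K Q ⟨2 * i, by have := i.2; omega⟩ + E K Q ⟨2 * Q - 1 - 2 * i, by have := i.2; omega⟩

variable {K} in
/-- `H_i = F_{2i} + F_{2Q-1-2i}`, for `0 ≤ i ≤ Q - 1`. -/
def H (A : K) (i : Fin Q) : W'Quot Q A :=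
  F Q A ⟨2 * i, by have := i.2; omega⟩ + F Q A ⟨2 * Q - 1 - 2 * i, by have := i.2; omega⟩

variable {K} in
/-- `γ` is the class of `(x^{2Q-2} y + x y^{2Q-2}) R` in `W' / g W₀`. -/
def γ [NeZero Q] (A : K) : W'Quot Q A :=
  classW' A ⟨toO K Q ((px K ^ (2 * Q - 2) * py K + px K * py K ^ (2 * Q - 2)) * pR K Q), by
    have hQ := NeZero.pos Q
    rw [add_mul, map_add]
    exact Submodule.mem_sup_left (Submodule.add_mem _
      (Submodule.subset_span ⟨2 * Q - 2, 1, by omega, by rw [pow_one]⟩)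
      (Submodule.subset_span ⟨1, 2 * Q - 2, by omega, by rw [pow_one]⟩))⟩

/-- `X ⊆ W / W₀` is spanned by the `G_i`. -/
def X : Submodule K (WQuot K Q) := Submodule.span K (Set.range (G K Q))

variable {K} in
/-- `Y ⊆ W' / g W₀` is spanned by the `H_i` together with `γ`. -/
def Y [NeZero Q] (A : K) : Submodule K (W'Quot Q A) :=
  Submodule.span K (Set.range (H Q A) ∪ {γ Q A})

variable {K Q} in
/-- `Φ : X → Y ⊕ O_{12Q-3}` is the map induced by `u ↦ (u g, u s)`, where `g = g_A` and `s` is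
the class of `x y f^Q`: whenever `u ∈ W` represents an element of `X`, the product `u g` lies
in `W'`, its class modulo `g W₀` is the first component of the image, and `u s` is the second
component. -/
def IsInducedMap [NeZero Q] (A : K)
    (Φ : X K Q →ₗ[K] (Y Q A × component K Q (12 * Q - 3))) : Prop :=
  ∀ (u : W K Q) (hu : classW u ∈ X K Q),
    (∃ hv : (u : O K Q) * toO K Q (pg A) ∈ W' K Q,
      ((Φ ⟨classW u, hu⟩).1 : W'Quot Q A) = classW' A ⟨(u : O K Q) * toO K Q (pg A), hv⟩) ∧
    ((Φ ⟨classW u, hu⟩).2 : O K Q) = (u : O K Q) * elemS K Q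

end Ring

end BrennerMonsky

end

namespace BrennerMonsky

/-! ### Special matrices in characteristic 2 and their rank. -/

section SpecialMatrices

/-! The second part is reduced to the first: multiplication by g and by s, written in suitable
bases, is a special matrix with rows B and C added.

Rank. Since 3 is a 2-adic unit, a special matrix splits along residues mod 3 into blocks T with zero
diagonal and other entries depending only on `ord_2 (i - j)`. Splitting a block by parity gives two
smaller blocks of the same kind with constant cross entries, and induction (`ultraEntry_solution`)
shows that T v = 0 with zero coordinate sum forces v = 0, the sum being automatically zero for
blocks of even size. As Q is 2 or 4 mod 6, one block has even size; rows B and C kill the sums of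
the two odd ones.

Multiplication by g. Repeated squaring expresses z^(4Q) through R and the P^(2^i)
(`pow_two_pow_expansion`). In O this power is 0, so P^Q is R plus terms in lower powers of P. Modulo
gW₀, P acts as A x²y², so E_r g becomes x^r y^(2Q-1-r) R plus a combination of the F_r' whose
coefficients are sums of A^(2^i) (`mul_pg_sub_mem_gW₀`). As A = β² + β, these sums telescope to
β^(2^e) + β. This vanishes on the diagonal, where e = m, and not for 0 < e < m, so the G_i to H_j
matrix is special (`multCoeff_eq_specialEntry`). The R-part of the image of G_i is γ unless i ≡ 2Q-1
mod 3, and 0 then.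

Multiplication by s. O_{12Q-3} is spanned by one monomial, and its coefficient in G_i s is 1 exactly
for i ≡ 2Q-1 mod 3 (`socleCoeff_pair`): this is row B, and adding the γ-coefficient gives row C.
Hence injectivity.

Nonmembership. The block of residue 2Q-1 has odd size and is singular. A kernel vector supported
there gives u, nonzero in X, with ug = gw for some w in W₀. If s = hg, then us = hgw = ws = 0,
because s annihilates W₀; this contradicts injectivity. -/

theorem sum_range_even_odd {M : Type*} [AddCommMonoid M] (f : ℕ → M) (n : ℕ) :
    ∑ j ∈ Finset.range n, f j =
      ∑ a ∈ Finset.range ((n + 1) / 2), f (2 * a) + ∑ a ∈ Finset.range (n / 2), f (2 * a + 1) := by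
  induction n with
  | zero => simp
  | succ n ih =>
    rw [Finset.sum_range_succ, ih]
    rcases Nat.even_or_odd' n with ⟨k, rfl | rfl⟩
    · rw [show (2 * k + 1) / 2 = k by omega, show (2 * k + 1 + 1) / 2 = k + 1 by omega,
        show 2 * k / 2 = k by omega, Finset.sum_range_succ, add_right_comm]
    · rw [show (2 * k + 1) / 2 = k by omega, show (2 * k + 1 + 1) / 2 = k + 1 by omega,
        show (2 * k + 1 + 1 + 1) / 2 = k + 1 by omega, Finset.sum_range_succ _ k,
        Finset.sum_range_succ (fun a => f (2 * a + 1)) k, add_assoc]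

theorem sum_range_mod_three {M : Type*} [AddCommMonoid M] (f : ℕ → M) (n : ℕ) :
    ∑ j ∈ Finset.range n, f j =
      ∑ a ∈ Finset.range ((n + 2) / 3), f (3 * a) + ∑ a ∈ Finset.range ((n + 1) / 3), f (3 * a + 1)
        + ∑ a ∈ Finset.range (n / 3), f (3 * a + 2) := by
  induction n with
  | zero => simp
  | succ n ih =>
    rw [Finset.sum_range_succ, ih]
    obtain ⟨k, rfl | rfl | rfl⟩ : ∃ k, n = 3 * k ∨ n = 3 * k + 1 ∨ n = 3 * k + 2 :=
      ⟨n / 3, by omega⟩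
    · rw [show (3 * k + 2) / 3 = k by omega, show (3 * k + 1 + 2) / 3 = k + 1 by omega,
        show (3 * k + 1) / 3 = k by omega,
        show 3 * k / 3 = k by omega, Finset.sum_range_succ _ k]
      abel
    · rw [show (3 * k + 1 + 2) / 3 = k + 1 by omega, show (3 * k + 1 + 1 + 2) / 3 = k + 1 by omega,
        show (3 * k + 1 + 1) / 3 = k by omega,
        show (3 * k + 1) / 3 = k by omega, Finset.sum_range_succ (fun a => f (3 * a + 1)) k]
      abel
    · rw [show (3 * k + 2 + 2) / 3 = k + 1 by omega, show (3 * k + 2 + 1 + 2) / 3 = k + 1 by omega,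
        show (3 * k + 2 + 1) / 3 = k + 1 by omega,
        show (3 * k + 2) / 3 = k by omega, Finset.sum_range_succ (fun a => f (3 * a + 2)) k]
      abel

variable {F : Type*} [Field F]

/-- The entry of the symmetric matrix with zero diagonal whose `(i, j)` entry depends only on the
2-adic order of `i - j`. -/
def ultraEntry (c : ℕ → F) (i j : ℕ) : F :=
  if i = j then 0 else c (padicValInt 2 ((i : ℤ) - (j : ℤ)))

theorem padicValInt_two_mul {d : ℤ} (hd : d ≠ 0) :
    padicValInt 2 (2 * d) = padicValInt 2 d + 1 := by
  rw [padicValInt.mul (by norm_num) hd, add_comm]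
  congr 1
  exact padicValInt_self

theorem padicValInt_two_odd {d : ℤ} (hd : d % 2 = 1) : padicValInt 2 d = 0 :=
  padicValInt.eq_zero_of_not_dvd (by push_cast; omega)

theorem padicValInt_two_three_mul (d : ℤ) : padicValInt 2 (3 * d) = padicValInt 2 d := by
  rcases eq_or_ne d 0 with rfl | hd
  · simp
  · rw [padicValInt.mul (by norm_num) hd, padicValInt_two_odd (by norm_num), zero_add]

theorem ultraEntry_two_mul (c : ℕ → F) (a b : ℕ) :
    ultraEntry c (2 * a) (2 * b) = ultraEntry (fun e => c (e + 1)) a b := by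
  unfold ultraEntry
  by_cases h : a = b
  · simp [h]
  · rw [if_neg (by omega), if_neg h]
    dsimp only
    rw [← padicValInt_two_mul (sub_ne_zero.mpr (by exact_mod_cast h)), mul_sub]
    push_cast; rfl

theorem ultraEntry_add_right (c : ℕ → F) (a b r : ℕ) :
    ultraEntry c (a + r) (b + r) = ultraEntry c a b := by
  unfold ultraEntry
  simp

theorem ultraEntry_three_mul (c : ℕ → F) (a b : ℕ) :
    ultraEntry c (3 * a) (3 * b) = ultraEntry c a b := by
  unfold ultraEntry
  by_cases h : a = b
  · simp [h]
  · rw [if_neg (by omega), if_neg h, ← padicValInt_two_three_mul (a - b), mul_sub]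
    push_cast; rfl

theorem ultraEntry_odd (c : ℕ → F) {a b : ℕ} (h : (a + b) % 2 = 1) :
    ultraEntry c a b = c 0 := by
  unfold ultraEntry
  rw [if_neg (by omega), padicValInt_two_odd (by omega)]

/-- Induction over the even-indexed and odd-indexed halves: each solves the same kind of system with
`c` shifted, the constant cross block only changing the right side to `l + c 0 * s`, with s the sum
over the other half. The three claims must be proved together: if both halves are odd, their claims
`l + c 0 * s1 = 0` and `l + c 0 * s0 = 0` give s0 + s1 = 0; if n is odd, the even half has sum 0, so
the odd half gives `l = 0`. -/
theorem ultraEntry_solution [CharP F 2] (n : ℕ) : ∀ (c : ℕ → F) (_ : ∀ e, c e ≠ 0) (v : ℕ → F)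
    (l : F) (_ : ∀ i < n, ∑ j ∈ Finset.range n, ultraEntry c i j * v j = l),
    (n % 2 = 0 → ∑ j ∈ Finset.range n, v j = 0) ∧ (n % 2 = 1 → l = 0) ∧
    (l = 0 → ∑ j ∈ Finset.range n, v j = 0 → ∀ i < n, v i = 0) := by
  induction n using Nat.strong_induction_on with
  | _ n ih =>
  intro c hc v l h
  rcases Nat.lt_or_ge n 2 with hn | hn
  · interval_cases n
    · simp
    · have := h 0 (by norm_num)
      simp [ultraEntry] at this
      simp [this]
  set p := (n + 1) / 2 with hp
  set q := n / 2 with hq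
  have h0 : ∀ a < p, ∑ b ∈ Finset.range p, ultraEntry (fun e => c (e + 1)) a b * v (2 * b) =
      l + c 0 * ∑ b ∈ Finset.range q, v (2 * b + 1) := by
    intro a ha
    have := h (2 * a) (by omega)
    rw [sum_range_even_odd] at this
    simp only [ultraEntry_two_mul] at this
    rw [← hp, ← hq, Finset.sum_congr (s₁ := Finset.range q) rfl (g := fun b => c 0 * v (2 * b + 1))
      (fun b _ => by rw [ultraEntry_odd c (by omega)]), ← Finset.mul_sum] at this
    rw [← this, add_assoc, CharTwo.add_self_eq_zero, add_zero]
  have h1 : ∀ a < q, ∑ b ∈ Finset.range q, ultraEntry (fun e => c (e + 1)) a b * v (2 * b + 1) =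
      l + c 0 * ∑ b ∈ Finset.range p, v (2 * b) := by
    intro a ha
    have := h (2 * a + 1) (by omega)
    rw [sum_range_even_odd] at this
    simp only [ultraEntry_add_right, ultraEntry_two_mul] at this
    rw [← hp, ← hq, Finset.sum_congr (s₁ := Finset.range p) rfl (g := fun b => c 0 * v (2 * b))
      (fun b _ => by rw [ultraEntry_odd c (by omega)]), ← Finset.mul_sum] at this
    rw [← this, add_right_comm, CharTwo.add_self_eq_zero, zero_add]
  obtain ⟨e0, o0, z0⟩ := ih p (by omega) _ (fun e => hc (e + 1)) _ _ h0
  obtain ⟨e1, o1, z1⟩ := ih q (by omega) _ (fun e => hc (e + 1)) _ _ h1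
  rw [sum_range_even_odd, ← hp, ← hq]
  set s0 := ∑ b ∈ Finset.range p, v (2 * b)
  set s1 := ∑ b ∈ Finset.range q, v (2 * b + 1)
  have hc0 := hc 0
  have key : l = 0 → s0 + s1 = 0 → ∀ i < n, v i = 0 := by
    intro hl hs
    subst hl
    have hs' : s0 = s1 := CharTwo.add_eq_zero.mp hs
    have hs0 : s0 = 0 := by
      rcases Nat.mod_two_eq_zero_or_one p with hp2 | hp2
      · exact e0 hp2
      · have := o0 hp2
        rw [← hs'] at this
        simpa [hc0] using this
    have hs1 : s1 = 0 := hs' ▸ hs0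
    intro i hi
    rcases Nat.even_or_odd' i with ⟨k, rfl | rfl⟩
    · exact z0 (by simp [hs1]) hs0 k (by omega)
    · exact z1 (by simp [hs0]) hs1 k (by omega)
  refine ⟨fun hn2 => ?_, fun hn2 => ?_, key⟩
  · rcases Nat.mod_two_eq_zero_or_one p with hp2 | hp2
    · rw [e0 hp2, e1 (by omega), add_zero]
    · have a0 := o0 hp2
      have a1 := o1 (by omega)
      have : c 0 * (s0 + s1) = 0 := by
        have : l + c 0 * s1 + (l + c 0 * s0) = 0 := by rw [a0, a1, add_zero]
        rw [← this]
        linear_combination (-l) * CharTwo.two_eq_zero (R := F)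
      simpa [hc0] using this
  · rcases Nat.mod_two_eq_zero_or_one p with hp2 | hp2
    · simpa [e0 hp2] using o1 (by omega)
    · simpa [e1 (by omega)] using o0 hp2

/-- Were the kernel trivial, the matrix would be onto and reach the all-ones vector, against the
vanishing of `l` for odd n. -/
theorem exists_ultraEntry_kernel [CharP F 2] {n : ℕ} (hn : n % 2 = 1) (c : ℕ → F)
    (hc : ∀ e, c e ≠ 0) :
    ∃ w : ℕ → F, (∃ i < n, w i ≠ 0) ∧
      ∀ i < n, ∑ j ∈ Finset.range n, ultraEntry c i j * w j = 0 := by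
  by_contra! hcon
  let T : Matrix (Fin n) (Fin n) F := Matrix.of fun i j => ultraEntry c i j
  let ext : (Fin n → F) → ℕ → F := fun v j => if hj : j < n then v ⟨j, hj⟩ else 0
  have hT : ∀ (v : Fin n → F) (i : Fin n),
      T.mulVec v i = ∑ j ∈ Finset.range n, ultraEntry c i j * ext v j := by
    intro v i
    rw [← Fin.sum_univ_eq_sum_range (fun j => ultraEntry c i j * ext v j)]
    simp [Matrix.mulVec, dotProduct, T, ext]
  have hinj : Function.Injective (Matrix.mulVecLin T) := by
    rw [← LinearMap.ker_eq_bot, LinearMap.ker_eq_bot']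
    intro v hv
    by_contra hv0
    obtain ⟨i, hi⟩ := Function.ne_iff.mp hv0
    obtain ⟨k, hk, hk'⟩ := hcon (ext v) ⟨i, i.2, by simpa [ext] using hi⟩
    apply hk'
    rw [← hT v ⟨k, hk⟩]
    exact congrFun hv _
  obtain ⟨v, hv⟩ := LinearMap.injective_iff_surjective.mp hinj (fun _ => 1)
  have := (ultraEntry_solution n c hc (ext v) 1 (fun i hi => by
    rw [← hT v ⟨i, hi⟩]; exact congrFun hv _)).2.1 hn
  exact one_ne_zero this

/-- The entries of a special matrix, indexed by natural numbers. -/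
def specialEntry (c : ℕ → F) (i j : ℕ) : F :=
  if i % 3 = j % 3 then ultraEntry c i j else 0

theorem IsSpecialMatrix.exists_specialEntry {Q : ℕ} {M : Matrix (Fin Q) (Fin Q) F}
    (hM : IsSpecialMatrix M) :
    ∃ c : ℕ → F, (∀ e, c e ≠ 0) ∧ ∀ i j : Fin Q, M i j = specialEntry c i j := by
  classical
  let good (e : ℕ) (x : Fin Q × Fin Q) : Prop :=
    (x.1 : ℕ) ≡ x.2 [MOD 3] ∧ x.1 ≠ x.2 ∧ padicValInt 2 ((x.1 : ℤ) - (x.2 : ℤ)) = e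
  -- Orders not realised by any admissible pair of indices get the value 1, so that `c` vanishes
  -- nowhere.
  refine ⟨fun e => if h : ∃ x, good e x then M h.choose.1 h.choose.2 else 1, fun e => ?_,
    fun i j => ?_⟩
  · dsimp only
    split_ifs with h
    · exact hM.ne_zero _ _ h.choose_spec.1 h.choose_spec.2.1
    · exact one_ne_zero
  · unfold specialEntry ultraEntry
    split_ifs with h1 h2
    · exact hM.eq_zero _ _ (Or.inl (Fin.ext h2))
    · have h3 : ∃ x, good (padicValInt 2 ((i : ℤ) - (j : ℤ))) x :=
        ⟨(i, j), h1, fun h => h2 (congrArg _ h), rfl⟩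
      dsimp only
      rw [dif_pos h3]
      exact hM.eq_of_ord_eq _ _ _ _ h1 (fun h => h2 (congrArg _ h)) h3.choose_spec.1
        h3.choose_spec.2.1 h3.choose_spec.2.2.symm
    · exact hM.eq_zero _ _ (Or.inr h1)

theorem sum_specialEntry (c : ℕ → F) (Q : ℕ) (v : ℕ → F) (a r : ℕ) (hr : r < 3) :
    ∑ j ∈ Finset.range Q, specialEntry c (3 * a + r) j * v j =
      ∑ b ∈ Finset.range ((Q + 2 - r) / 3), ultraEntry c a b * v (3 * b + r) := by
  rw [sum_range_mod_three]
  have h0 : ∀ b s, specialEntry c (3 * a + r) (3 * b + s) =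
      if r % 3 = s % 3 then ultraEntry c (3 * a + r) (3 * b + s) else 0 := by
    intro b s
    simp [specialEntry, Nat.add_mod]
  have h0' := fun b => h0 b 0
  simp only [add_zero] at h0'
  simp only [h0, h0']
  interval_cases r <;> simp [ultraEntry_add_right, ultraEntry_three_mul]

/-- The blocks have sizes (Q+2)/3, (Q+1)/3 and Q/3. For Q ≡ 2 mod 6 the residue 2 block is even and
B controls residue 0; for Q ≡ 4 the residue 0 block is even and B controls residue 1. In both cases
C supplies the remaining sum. -/
theorem specialEntry_trivial_kernel [CharP F 2] {c : ℕ → F} (hc : ∀ e, c e ≠ 0) {Q : ℕ}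
    (hQ : Q % 6 = 2 ∨ Q % 6 = 4) {v : ℕ → F}
    (hM : ∀ i < Q, ∑ j ∈ Finset.range Q, specialEntry c i j * v j = 0)
    (hB : ∑ j ∈ Finset.range Q, (if j % 3 = (2 * Q - 1) % 3 then v j else 0) = 0)
    (hC : ∑ j ∈ Finset.range Q, v j = 0) : ∀ i < Q, v i = 0 := by
  have hcl : ∀ r < 3, _ := fun r hr => ultraEntry_solution ((Q + 2 - r) / 3) c hc
    (fun b => v (3 * b + r)) 0 (fun a ha => by
      rw [← sum_specialEntry c Q v a r hr]; exact hM _ (by omega))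
  obtain ⟨e0, -, z0⟩ := hcl 0 (by norm_num)
  obtain ⟨e1, -, z1⟩ := hcl 1 (by norm_num)
  obtain ⟨e2, -, z2⟩ := hcl 2 (by norm_num)
  rw [sum_range_mod_three] at hB hC
  rw [show Q + 2 - 1 = Q + 1 by omega] at e1 z1
  rw [show Q + 2 - 2 = Q by omega] at e2 z2
  simp only [Nat.sub_zero, add_zero, forall_true_left] at e0 z0 e1 z1 e2 z2
  set s0 := ∑ a ∈ Finset.range ((Q + 2) / 3), v (3 * a)
  set s1 := ∑ a ∈ Finset.range ((Q + 1) / 3), v (3 * a + 1)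
  set s2 := ∑ a ∈ Finset.range (Q / 3), v (3 * a + 2)
  have hs : s0 = 0 ∧ s1 = 0 ∧ s2 = 0 := by
    rcases hQ with h | h
    · rw [show (2 * Q - 1) % 3 = 0 by omega] at hB
      simp [Nat.add_mod] at hB
      have := e2 (by omega)
      change s0 = 0 at hB
      simp_all
    · rw [show (2 * Q - 1) % 3 = 1 by omega] at hB
      simp [Nat.add_mod] at hB
      have := e0 (by omega)
      change s1 = 0 at hB
      simp_all
  intro i hi
  obtain ⟨k, rfl | rfl | rfl⟩ : ∃ k, i = 3 * k ∨ i = 3 * k + 1 ∨ i = 3 * k + 2 := ⟨i / 3, by omega⟩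
  · exact z0 hs.1 k (by omega)
  · exact z1 hs.2.1 k (by omega)
  · exact z2 hs.2.2 k (by omega)

theorem exists_specialEntry_kernel [CharP F 2] {c : ℕ → F} (hc : ∀ e, c e ≠ 0) {Q : ℕ}
    (hQ : Q % 6 = 2 ∨ Q % 6 = 4) :
    ∃ v : ℕ → F, (∃ i < Q, v i ≠ 0) ∧
      (∀ i < Q, ∑ j ∈ Finset.range Q, specialEntry c i j * v j = 0) ∧
      ∀ j, j % 3 ≠ (2 * Q - 1) % 3 → v j = 0 := by
  set r := (2 * Q - 1) % 3 with hr
  obtain ⟨w, ⟨i, hi, hwi⟩, hw⟩ := exists_ultraEntry_kernel (n := (Q + 2 - r) / 3) (by omega) c hc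
  have hr3 : r < 3 := Nat.mod_lt _ (by norm_num)
  have hv : ∀ b, (3 * b + r) % 3 = r ∧ (3 * b + r) / 3 = b := fun b => by omega
  refine ⟨fun j => if j % 3 = r then w (j / 3) else 0, ⟨3 * i + r, by omega, ?_⟩, ?_, ?_⟩
  · simpa [hv] using hwi
  · intro k hk
    by_cases hkr : k % 3 = r
    · rw [show k = 3 * (k / 3) + r by omega, sum_specialEntry c Q _ _ r hr3]
      simp only [hv, if_true]
      exact hw _ (by omega)
    · refine Finset.sum_eq_zero fun j _ => ?_
      by_cases hj : j % 3 = r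
      · rw [specialEntry, if_neg (by omega), zero_mul]
      · simp only [if_neg hj, mul_zero]
  · intro j hj
    exact if_neg hj

theorem two_pow_mod_six {n : ℕ} (hn : 1 ≤ n) : 2 ^ n % 6 = 2 ∨ 2 ^ n % 6 = 4 := by
  induction n, hn using Nat.le_induction with
  | base => simp
  | succ n _ ih => rw [pow_succ]; omega

theorem rank_stacked [CharP F 2] {Q : ℕ} (hQ : Q % 6 = 2 ∨ Q % 6 = 4)
    {M : Matrix (Fin Q) (Fin Q) F} (hM : IsSpecialMatrix M) : (stacked M).rank = Q := by
  obtain ⟨c, hc, hMc⟩ := hM.exists_specialEntry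
  have hinj : Function.Injective (Matrix.mulVecLin (stacked M)) := by
    rw [← LinearMap.ker_eq_bot, LinearMap.ker_eq_bot']
    intro v hv
    let w : ℕ → F := fun j => if hj : j < Q then v ⟨j, hj⟩ else 0
    have hw : ∀ j : Fin Q, w j = v j := fun j => by simp [w]
    have hsum : ∀ g : ℕ → F, ∑ j ∈ Finset.range Q, g j * w j = ∑ j : Fin Q, g j * v j := by
      intro g
      rw [← Fin.sum_univ_eq_sum_range (fun j => g j * w j)]
      simp only [hw]
    have := specialEntry_trivial_kernel hc hQ (v := w) (fun i hi => by
        rw [hsum]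
        simpa [stacked, Matrix.mulVec, dotProduct, hMc] using congrFun hv (Sum.inl ⟨i, hi⟩))
      (by
        have h := hsum (fun j => if j % 3 = (2 * Q - 1) % 3 then 1 else 0)
        simp only [ite_mul, one_mul, zero_mul] at h
        rw [h]
        have h' := congrFun hv (Sum.inr 0)
        simp only [stacked, Matrix.mulVecLin_apply, Matrix.mulVec, dotProduct,
          Matrix.fromRows_apply_inr, Matrix.of_apply, Matrix.cons_val_zero, Pi.zero_apply] at h'
        refine Eq.trans (Finset.sum_congr rfl fun j _ => ?_) h'
        by_cases hj : (j : ℕ) % 3 = (2 * Q - 1) % 3 <;> simp [rowB, Nat.ModEq, hj])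
      (by
        have h := hsum (fun _ => 1)
        simp only [one_mul] at h
        rw [h]
        simpa [stacked, Matrix.mulVec, dotProduct, rowC] using congrFun hv (Sum.inr 1))
    funext i
    rw [← hw]
    exact this i i.2
  have h := LinearMap.finrank_range_of_inj hinj
  rw [Matrix.rank, h]
  simp

end SpecialMatrices

end BrennerMonsky

namespace BrennerMonsky

/-! ### Sums of monomials with congruent exponents, and powers of z. -/

section MonomialSums

variable {S : Type*} [CommRing S]

/-- The sum of all `x ^ a * y ^ b` with `a + b = d` and `a ≡ b` mod `3`. -/
def congrSum (x y : S) (d : ℕ) : S :=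
  ∑ a ∈ Finset.range (d + 1), if (a + d) % 3 = 0 then x ^ a * y ^ (d - a) else 0

theorem congrSum_pow_two_pow [CharP S 2] (x y : S) (d k : ℕ) :
    congrSum x y d ^ 2 ^ k = ∑ a ∈ Finset.range (d + 1),
      if (a + d) % 3 = 0 then x ^ (2 ^ k * a) * y ^ (2 ^ k * (d - a)) else 0 := by
  rw [congrSum, sum_pow_char_pow 2]
  refine Finset.sum_congr rfl fun a _ => ?_
  split_ifs
  · rw [mul_pow, ← pow_mul', ← pow_mul']
  · exact zero_pow (by positivity)

theorem congrSum_sq [CharP S 2] (x y : S) (d : ℕ) :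
    congrSum x y d ^ 2 = ∑ a ∈ Finset.range (d + 1),
      if (a + d) % 3 = 0 then x ^ (2 * a) * y ^ (2 * (d - a)) else 0 := by
  simpa using congrSum_pow_two_pow x y d 1

theorem congrSum_even [CharP S 2] (x y : S) (d : ℕ) :
    congrSum x y (2 * d + 2) = x * y * congrSum x y d ^ 2 + congrSum x y (d + 1) ^ 2 := by
  rw [congrSum_sq, congrSum_sq, congrSum, sum_range_even_odd,
    show (2 * d + 2 + 1 + 1) / 2 = d + 1 + 1 by omega, show (2 * d + 2 + 1) / 2 = d + 1 by omega,
    add_comm, Finset.mul_sum]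
  congr 1
  · refine Finset.sum_congr rfl fun a ha => ?_
    rw [Finset.mem_range] at ha
    by_cases h : (a + d) % 3 = 0
    · rw [if_pos h, if_pos (by omega), show 2 * d + 2 - (2 * a + 1) = 2 * (d - a) + 1 by omega]
      ring
    · rw [if_neg h, if_neg (by omega), mul_zero]
  · refine Finset.sum_congr rfl fun a ha => ?_
    rw [Finset.mem_range] at ha
    by_cases h : (a + (d + 1)) % 3 = 0
    · rw [if_pos h, if_pos (by omega), show 2 * d + 2 - 2 * a = 2 * (d + 1 - a) by omega]
    · rw [if_neg h, if_neg (by omega)]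

/-- Terms with odd and even exponent of x come from x³ and y³ respectively. The condition on `d`
discards the two unmatched monomials x^(2d+2) y and x y^(2d+2). -/
theorem congrSum_odd [CharP S 2] (x y : S) {d : ℕ} (hd : d % 3 ≠ 1) :
    congrSum x y (2 * d + 3) = (x ^ 3 + y ^ 3) * congrSum x y d ^ 2 := by
  rw [congrSum_sq, congrSum, sum_range_even_odd,
    show (2 * d + 3 + 1 + 1) / 2 = d + 1 + 1 by omega,
    show (2 * d + 3 + 1) / 2 = d + 1 + 1 by omega,
    Finset.sum_range_succ _ (d + 1), Finset.sum_range_succ' _ (d + 1),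
    if_neg (show ¬(2 * (d + 1) + (2 * d + 3)) % 3 = 0 by omega),
    if_neg (show ¬(2 * 0 + 1 + (2 * d + 3)) % 3 = 0 by omega),
    add_zero, add_zero, add_comm, add_mul, Finset.mul_sum, Finset.mul_sum]
  congr 1
  · refine Finset.sum_congr rfl fun a ha => ?_
    rw [Finset.mem_range] at ha
    by_cases h : (a + d) % 3 = 0
    · rw [if_pos h, if_pos (by omega),
        show 2 * d + 3 - (2 * (a + 1) + 1) = 2 * (d - a) by omega]
      ring
    · rw [if_neg h, if_neg (by omega), mul_zero]
  · refine Finset.sum_congr rfl fun a ha => ?_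
    rw [Finset.mem_range] at ha
    by_cases h : (a + d) % 3 = 0
    · rw [if_pos h, if_pos (by omega), show 2 * d + 3 - 2 * a = 2 * (d - a) + 3 by omega]
      ring
    · rw [if_neg h, if_neg (by omega), mul_zero]

/-- The expansion of `z ^ 2 ^ (k + 1)` in terms of `z`, `z ^ 2` and the powers `P ^ 2 ^ i`, where
`P = z ^ 4 + x y z ^ 2 + x ^ 3 z + y ^ 3 z`. -/
theorem pow_two_pow_expansion [CharP S 2] {x y z P : S}
    (hP : P = z ^ 4 + x * y * z ^ 2 + x ^ 3 * z + y ^ 3 * z) (k : ℕ) :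
    z ^ 2 ^ (k + 1) = congrSum x y (2 ^ (k + 1) - 2) * z ^ 2 + congrSum x y (2 ^ (k + 1) - 1) * z +
      ∑ i ∈ Finset.range k, congrSum x y (2 ^ (k - i) - 2) ^ 2 ^ (i + 1) * P ^ 2 ^ i := by
  induction k with
  | zero => simp [congrSum, Finset.sum_range_succ]
  | succ k ih =>
    -- Squaring the expansion is additive in characteristic 2 and leaves only z⁴ out of shape.
    -- Replacing it by P + xyz² + (x³+y³)z creates the new P-term, and the recursions for `congrSum`
    -- identify the new coefficients of z² and z.
    have hz : z ^ 4 = P + x * y * z ^ 2 + (x ^ 3 + y ^ 3) * z := by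
      rw [hP]
      linear_combination (-(x * y * z ^ 2) - (x ^ 3 + y ^ 3) * z) * CharTwo.two_eq_zero (R := S)
    obtain ⟨d, hd⟩ : ∃ d, 2 ^ (k + 1) = d + 2 :=
      ⟨2 ^ (k + 1) - 2, by have := Nat.one_le_two_pow (n := k); rw [pow_succ]; omega⟩
    have hd3 : d % 3 ≠ 1 := by
      have := two_pow_mod_six (n := k + 1) (by omega)
      omega
    have h2 : 2 ^ (k + 1 + 1) = 2 * d + 4 := by rw [pow_succ, hd]; ring
    rw [show z ^ 2 ^ (k + 1 + 1) = (z ^ 2 ^ (k + 1)) ^ 2 by rw [← pow_mul, ← pow_succ], ih, CharTwo.add_sq, CharTwo.add_sq, CharTwo.sum_sq,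
      Finset.sum_range_succ', h2, hd]
    simp only [show d + 2 - 2 = d by omega, show d + 2 - 1 = d + 1 by omega,
      show 2 * d + 4 - 2 = 2 * d + 2 by omega, show 2 * d + 4 - 1 = 2 * d + 3 by omega, mul_pow,
      congrSum_even, congrSum_odd x y hd3, Nat.add_sub_add_right, Nat.sub_zero, hd]
    have hs : ∀ i, (congrSum x y (2 ^ (k - i) - 2) ^ 2 ^ (i + 1)) ^ 2 * (P ^ 2 ^ i) ^ 2 =
        congrSum x y (2 ^ (k - i) - 2) ^ 2 ^ (i + 1 + 1) * P ^ 2 ^ (i + 1) := by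
      intro i
      rw [← pow_mul, ← pow_mul, ← pow_succ, ← pow_succ]
    simp only [hs]
    rw [← pow_mul z 2 2, hz]
    simp only [zero_add, pow_zero, pow_one]
    ring

end MonomialSums

/-! ### The element β and sums of iterated squares of A. -/

section FieldElement

/-- Telescoping, since A^(2^j) = β^(2^(j+1)) + β^(2^j). -/
theorem sum_pow_two_pow {K : Type*} [Field K] [CharP K 2] {A β : K} (h : β ^ 2 + β = A) (e : ℕ) :
    ∑ j ∈ Finset.range e, A ^ 2 ^ j = β ^ 2 ^ e + β := by
  induction e with
  | zero => simp [CharTwo.add_self_eq_zero]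
  | succ e ih =>
    rw [Finset.sum_range_succ, ih, ← h, add_pow_char_pow, ← pow_mul, ← pow_succ']
    linear_combination β ^ 2 ^ e * CharTwo.two_eq_zero (R := K)

variable {K : Type*} [Field K] [Algebra (ZMod 2) K] [IsAlgClosure (ZMod 2) K]

theorem pow_two_pow_eq_self_iff (β : K) (j : ℕ) :
    β ^ 2 ^ j = β ↔ (minpoly (ZMod 2) β).natDegree ∣ j := by
  have hint : IsIntegral (ZMod 2) β :=
    ((IsAlgClosure.isAlgebraic (R := ZMod 2) (K := K)).isAlgebraic β).isIntegral
  have h := (minpoly.irreducible hint).natDegree_dvd_iff_dvd_X_pow_card_pow_sub_X (n := j)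
  rw [h, minpoly.dvd_iff, Nat.card_zmod]
  simp [sub_eq_zero]

end FieldElement

end BrennerMonsky

noncomputable section
namespace BrennerMonsky

/-! ### Powers of z⁴ + bz² + az and division by a translate. -/

section LinearizedQuartic

open Polynomial

variable {S : Type*} [CommRing S]

theorem coeff_sq_two_mul [CharP S 2] (p : S[X]) (m : ℕ) :
    (p ^ 2).coeff (2 * m) = p.coeff m ^ 2 := by
  rw [← Polynomial.map_frobenius_expand (p := 2), Polynomial.coeff_map, mul_comm,
    Polynomial.coeff_expand_mul (by norm_num)]
  rfl

theorem coeff_sq_two_mul_add_one [CharP S 2] (p : S[X]) (m : ℕ) :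
    (p ^ 2).coeff (2 * m + 1) = 0 := by
  rw [← Polynomial.map_frobenius_expand (p := 2), Polynomial.coeff_map, Polynomial.coeff_expand (by norm_num),
    if_neg (by omega), map_zero]

/-- The quartic `z ^ 4 + b z ^ 2 + a z`. -/
def quartic (a b : S) : S[X] := Polynomial.X ^ 4 + C b * Polynomial.X ^ 2 + C a * Polynomial.X

/-- The exponent 2^n - 1 is odd for n > 0, and squares have no odd coefficients. So even powers
contribute nothing, and in an odd power only the summand `a` z times a square survives, which leads
to the case n - 1. -/
theorem coeff_quartic_pow [CharP S 2] (a b : S) (n : ℕ) : ∀ k < 2 ^ n,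
    (quartic a b ^ k).coeff (2 ^ n - 1) = if k = 2 ^ n - 1 then a ^ (2 ^ n - 1) else 0 := by
  induction n with
  | zero =>
    intro k hk
    obtain rfl : k = 0 := by simpa using hk
    simp
  | succ n ih =>
    intro k hk
    have h1 := Nat.one_le_two_pow (n := n)
    rw [show 2 ^ (n + 1) - 1 = 2 * (2 ^ n - 1) + 1 by rw [pow_succ]; omega]
    rw [pow_succ] at hk
    rcases Nat.even_or_odd' k with ⟨k, rfl | rfl⟩
    · rw [mul_comm 2 k, pow_mul, coeff_sq_two_mul_add_one, if_neg (by omega)]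
    · have : quartic a b ^ (2 * k + 1) = (quartic a b ^ k * Polynomial.X ^ 2) ^ 2 +
          C b * (quartic a b ^ k * Polynomial.X) ^ 2 + C a * ((quartic a b ^ k) ^ 2 * Polynomial.X) := by
        rw [pow_succ, mul_comm 2 k, pow_mul]
        nth_rw 2 [quartic]
        ring
      rw [this, coeff_add, coeff_add, coeff_C_mul, coeff_C_mul, coeff_sq_two_mul_add_one,
        coeff_sq_two_mul_add_one, coeff_mul_X, coeff_sq_two_mul, ih k (by omega)]
      by_cases hk' : k = 2 ^ n - 1
      · rw [if_pos hk', if_pos (by omega), ← pow_mul, mul_comm 2, pow_succ a]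
        ring
      · rw [if_neg hk', if_neg (by omega)]
        ring

theorem quartic_sub_C_monic (a b c : S) : (quartic a b - C c).Monic := by
  unfold quartic
  monicity!

variable [Nontrivial S]

theorem natDegree_quartic (a b : S) : (quartic a b).natDegree = 4 := by
  unfold quartic
  compute_degree!

theorem natDegree_quartic_sub_C (a b c : S) : (quartic a b - C c).natDegree = 4 := by
  rw [natDegree_sub_C, natDegree_quartic]

theorem modByMonic_of_natDegree_lt {p q : S[X]} (hq : q.Monic) (h : p.natDegree < q.natDegree) :
    p %ₘ q = p :=
  (modByMonic_eq_self_iff hq).mpr (degree_lt_degree h)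

theorem mod_X_pow_of_natDegree_lt {p : S[X]} {N : ℕ} (h : p.natDegree < N) :
    p %ₘ Polynomial.X ^ N = p :=
  modByMonic_of_natDegree_lt (monic_X_pow N) (by rwa [natDegree_X_pow])

theorem natDegree_C_mul_quartic_pow_le (s a b : S) (k : ℕ) :
    (C s * quartic a b ^ k).natDegree ≤ 4 * k := by
  refine (natDegree_C_mul_le _ _).trans (natDegree_pow_le.trans ?_)
  rw [natDegree_quartic, mul_comm]

/-- The product has z-degree at most 4(k+1) < 4Q, so truncating z at 4Q does not change it and it
stays divisible by the quartic. This makes the remainder forms vanish on gW₀. -/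
theorem mod_mul_C_mul_quartic_pow (s a b c : S) {k Q : ℕ} (hk : k + 1 < Q) :
    ((quartic a b - C c) * (C s * quartic a b ^ k)) %ₘ Polynomial.X ^ (4 * Q) %ₘ (quartic a b - C c) = 0 := by
  rw [mod_X_pow_of_natDegree_lt, self_mul_modByMonic]
  · exact quartic_sub_C_monic a b c
  · refine natDegree_mul_le.trans_lt ?_
    have := natDegree_C_mul_quartic_pow_le s a b k
    rw [natDegree_quartic_sub_C]
    omega

theorem mod_of_natDegree_lt_four {p : S[X]} (a b c : S) {Q : ℕ} (hQ : 1 ≤ Q)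
    (hp : p.natDegree < 4) : p %ₘ Polynomial.X ^ (4 * Q) %ₘ (quartic a b - C c) = p := by
  rw [mod_X_pow_of_natDegree_lt (by omega), modByMonic_of_natDegree_lt (quartic_sub_C_monic a b c)]
  rwa [natDegree_quartic_sub_C]

end LinearizedQuartic

/-! ### Linear forms on O by way of K[x][y][z]. -/

section Iterated

open Polynomial

variable (K : Type*) [Field K]

/-- The ring `K[x][y][z]`. -/
abbrev Tri : Type _ := K[X][X][X]

/-- The identification of `K[x, y, z]` with `K[x][y][z]`. -/
def toTri : Poly K →ₐ[K] Tri K := MvPolynomial.aeval (![C (C Polynomial.X), C Polynomial.X, Polynomial.X] : Fin 3 → Tri K)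

variable {K}

@[simp] theorem toTri_px : toTri K (px K) = C (C Polynomial.X) := by simp [toTri, px]

@[simp] theorem toTri_py : toTri K (py K) = C Polynomial.X := by simp [toTri, py]

@[simp] theorem toTri_pz : toTri K (pz K) = Polynomial.X := by simp [toTri, pz]

@[simp] theorem toTri_C (a : K) : toTri K (MvPolynomial.C a) = C (C (C a)) := by
  simp [toTri]

/-- The monomial `x ^ a * y ^ b` of `K[x][y]`. -/
def xy (K : Type*) [Field K] (a b : ℕ) : K[X][X] := C (Polynomial.X ^ a) * Polynomial.X ^ b

@[simp] theorem toTri_monomial (a b : ℕ) : toTri K (px K ^ a * py K ^ b) = C (xy K a b) := by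
  simp [xy]

theorem toTri_pP : toTri K (pP K) =
    quartic (C Polynomial.X ^ 3 + Polynomial.X ^ 3 : K[X][X]) (C Polynomial.X * Polynomial.X) := by
  simp [pP, quartic]
  ring

theorem toTri_pg [CharP K 2] (A : K) : toTri K (pg A) =
    (quartic (C Polynomial.X ^ 3 + Polynomial.X ^ 3 : K[X][X]) (C Polynomial.X * Polynomial.X) -
      C (C (C A) * xy K 2 2) : Tri K) := by
  rw [pg, map_add, toTri_pP, CharTwo.sub_eq_add]
  simp [xy]
  ring

theorem coeff_xy_mul (a b i j : ℕ) (p : K[X][X]) :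
    ((xy K a b * p).coeff j).coeff i =
      if a ≤ i ∧ b ≤ j then (p.coeff (j - b)).coeff (i - a) else 0 := by
  rw [xy, mul_assoc, coeff_C_mul, coeff_X_pow_mul', coeff_X_pow_mul']
  by_cases h : a ≤ i <;> by_cases h' : b ≤ j <;> simp [h, h']

theorem coeff_xy (a b i j : ℕ) :
    ((xy K a b).coeff j).coeff i = if a = i ∧ b = j then 1 else 0 := by
  rw [xy, coeff_C_mul, coeff_X_pow, mul_ite, mul_one, mul_zero]
  by_cases h : j = b
  · simp [h, coeff_X_pow, eq_comm]
  · simp [h, Ne.symm h]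

theorem xy_mul (a b c d : ℕ) : xy K a b * xy K c d = xy K (a + c) (b + d) := by
  simp only [xy, map_pow]
  ring

variable (K) in
/-- The coefficient of `x ^ a * y ^ b * z ^ c`. -/
def triCoeff (a b c : ℕ) : Tri K →ₗ[K] K where
  toFun p := ((p.coeff c).coeff b).coeff a
  map_add' p q := by simp
  map_smul' r p := by simp

theorem triCoeff_apply (a b c : ℕ) (p : Tri K) :
    triCoeff K a b c p = ((p.coeff c).coeff b).coeff a := rfl

theorem triCoeff_C_xy_mul_of_lt {a b c i j : ℕ} (h : ¬ (i ≤ a ∧ j ≤ b)) (p : Tri K) :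
    triCoeff K a b c (C (xy K i j) * p) = 0 := by
  rw [triCoeff_apply, coeff_C_mul, coeff_xy_mul, if_neg h]

/-- A linear form on `K[x, y, z]` vanishing on the multiples of `x ^ N`, `y ^ N` and `z ^ N`
vanishes on the ideal these generate. -/
theorem eq_zero_of_mem_span_pow {M : Type*} [AddCommMonoid M] [Module K M] {N : ℕ}
    (L : Poly K →ₗ[K] M)
    (hx : ∀ p, L (px K ^ N * p) = 0) (hy : ∀ p, L (py K ^ N * p) = 0)
    (hz : ∀ p, L (pz K ^ N * p) = 0) {p : Poly K}
    (hp : p ∈ (Ideal.span {px K ^ N, py K ^ N, pz K ^ N} : Ideal (Poly K))) : L p = 0 := by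
  obtain ⟨a, q, hq, rfl⟩ := Ideal.mem_span_insert.mp hp
  obtain ⟨b, r, hr, rfl⟩ := Ideal.mem_span_insert.mp hq
  obtain ⟨c, rfl⟩ := Ideal.mem_span_singleton'.mp hr
  rw [map_add, map_add, mul_comm a, mul_comm b, mul_comm c, hx, hy, hz, add_zero, add_zero]

/-- The linear form on `O` induced by a linear form on `K[x, y, z]`. -/
def descend (Q : ℕ) (L : Poly K →ₗ[K] K)
    (hL : ∀ p ∈ (Ideal.span {px K ^ (4 * Q), py K ^ (4 * Q), pz K ^ (4 * Q)} : Ideal (Poly K)),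
      L p = 0) : O K Q →ₗ[K] K :=
  (Submodule.liftQ ((Ideal.span {px K ^ (4 * Q), py K ^ (4 * Q), pz K ^ (4 * Q)} :
    Ideal (Poly K)).restrictScalars K) L hL).comp
    (Submodule.Quotient.restrictScalarsEquiv K _).symm.toLinearMap

/-- The coefficient of `x ^ (4Q-1) * y ^ (4Q-1) * z ^ (4Q-1)`, as a linear form on `O`. -/
def socleCoeff (K : Type*) [Field K] (Q : ℕ) [NeZero Q] : O K Q →ₗ[K] K :=
  descend Q ((triCoeff K (4 * Q - 1) (4 * Q - 1) (4 * Q - 1)).comp (toTri K).toLinearMap) (by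
    have hQ := NeZero.pos Q
    intro p hp
    refine eq_zero_of_mem_span_pow _ (fun q => ?_) (fun q => ?_) (fun q => ?_) hp
    · have := triCoeff_C_xy_mul_of_lt (K := K) (a := 4 * Q - 1) (b := 4 * Q - 1) (c := 4 * Q - 1)
        (i := 4 * Q) (j := 0) (by omega) (toTri K q)
      simpa [xy] using this
    · have := triCoeff_C_xy_mul_of_lt (K := K) (a := 4 * Q - 1) (b := 4 * Q - 1) (c := 4 * Q - 1)
        (i := 0) (j := 4 * Q) (by omega) (toTri K q)
      simpa [xy] using this
    · simp only [LinearMap.comp_apply, AlgHom.toLinearMap_apply, map_mul, map_pow, toTri_pz,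
        triCoeff_apply, coeff_X_pow_mul']
      rw [if_neg (by omega)]
      simp)

theorem socleCoeff_toO (Q : ℕ) [NeZero Q] (p : Poly K) : socleCoeff K Q (toO K Q p) =
    triCoeff K (4 * Q - 1) (4 * Q - 1) (4 * Q - 1) (toTri K p) := rfl

/-- The coefficient of `x ^ a * y ^ b * z ^ c`, for `a, b < 4Q`, in the remainder modulo `g_A` of
the representative of degree less than `4Q` in `z`. -/
def remCoeff (Q : ℕ) (A : K) (a b c : ℕ) (ha : a < 4 * Q) (hb : b < 4 * Q) : O K Q →ₗ[K] K :=
  descend Q ((triCoeff K a b c).comp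
    (((modByMonicHom (toTri K (pg A))).restrictScalars K).comp
      (((modByMonicHom (Polynomial.X ^ (4 * Q) : Tri K)).restrictScalars K).comp (toTri K).toLinearMap)))
    (by
      intro p hp
      refine eq_zero_of_mem_span_pow _ (fun q => ?_) (fun q => ?_) (fun q => ?_) hp
      · simp only [LinearMap.comp_apply, AlgHom.toLinearMap_apply, map_mul, map_pow, toTri_px,
          LinearMap.restrictScalars_apply]
        rw [← C_pow, ← smul_eq_C_mul, map_smul, map_smul, smul_eq_C_mul]
        have := triCoeff_C_xy_mul_of_lt (K := K) (a := a) (b := b) (c := c)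
          (i := 4 * Q) (j := 0) (by omega)
        simpa [xy] using this _
      · simp only [LinearMap.comp_apply, AlgHom.toLinearMap_apply, map_mul, map_pow, toTri_py,
          LinearMap.restrictScalars_apply]
        rw [← C_pow, ← smul_eq_C_mul, map_smul, map_smul, smul_eq_C_mul]
        have := triCoeff_C_xy_mul_of_lt (K := K) (a := a) (b := b) (c := c)
          (i := 0) (j := 4 * Q) (by omega)
        simpa [xy] using this _
      · simp only [LinearMap.comp_apply, AlgHom.toLinearMap_apply, map_mul, map_pow, toTri_pz,
          LinearMap.restrictScalars_apply, modByMonicHom_apply]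
        rw [self_mul_modByMonic (monic_X_pow _), zero_modByMonic, map_zero])

theorem remCoeff_toO (Q : ℕ) (A : K) (a b c : ℕ) (ha : a < 4 * Q) (hb : b < 4 * Q) (p : Poly K) :
    remCoeff Q A a b c ha hb (toO K Q p) =
      triCoeff K a b c (toTri K p %ₘ Polynomial.X ^ (4 * Q) %ₘ toTri K (pg A)) := rfl

end Iterated

end BrennerMonsky
end

noncomputable section
namespace BrennerMonsky

/-! ### Multiplication by g in O modulo gW₀. -/

section TruncatedRing

variable {K : Type*} [Field K] {Q : ℕ}

theorem toO_eq_zero_of_dvd {p q : Poly K}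
    (hq : q = px K ^ (4 * Q) ∨ q = py K ^ (4 * Q) ∨ q = pz K ^ (4 * Q)) (h : q ∣ p) :
    toO K Q p = 0 := by
  refine Ideal.Quotient.eq_zero_iff_mem.mpr (Ideal.mem_of_dvd _ h (Ideal.subset_span ?_))
  simpa using hq

variable (K Q) in
/-- The class of `x ^ a * y ^ b` in `O`. -/
def mon (a b : ℕ) : O K Q := toO K Q (px K ^ a * py K ^ b)

theorem mon_eq_zero {a b : ℕ} (h : 4 * Q ≤ a ∨ 4 * Q ≤ b) : mon K Q a b = 0 := by
  rcases h with h | h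
  · exact toO_eq_zero_of_dvd (Or.inl rfl) ((pow_dvd_pow _ h).mul_right _)
  · exact toO_eq_zero_of_dvd (Or.inr (Or.inl rfl)) ((pow_dvd_pow _ h).mul_left _)

theorem toO_C_mul (c : K) (p : Poly K) : toO K Q (MvPolynomial.C c * p) = c • toO K Q p := by
  rw [MvPolynomial.C_mul', map_smul]

theorem pR_eq_congrSum (hQ : 1 ≤ Q) : pR K Q = congrSum (px K) (py K) (4 * Q - 2) * pz K ^ 2 +
    congrSum (px K) (py K) (4 * Q - 1) * pz K := by
  have key : ∀ k, 1 ≤ k → k ≤ 4 * Q → ∑ i ∈ Finset.range (4 * Q + 1),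
      ∑ j ∈ Finset.range (4 * Q + 1), (if i + j + k = 4 * Q ∧ i ≡ j [MOD 3] then
        px K ^ i * py K ^ j * pz K ^ k else 0) =
      congrSum (px K) (py K) (4 * Q - k) * pz K ^ k := by
    intro k hk hk'
    rw [congrSum, Finset.sum_mul]
    symm
    refine Finset.sum_subset_zero_on_sdiff (Finset.range_subset_range.mpr (by omega)) ?_ ?_
    · intro i hi
      simp only [Finset.mem_sdiff, Finset.mem_range] at hi
      exact Finset.sum_eq_zero fun j _ => if_neg (by omega)
    · intro i hi
      rw [Finset.mem_range] at hi
      rw [Finset.sum_eq_single (4 * Q - k - i)]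
      · by_cases h : (i + (4 * Q - k)) % 3 = 0
        · rw [if_pos h, if_pos ⟨by omega, by unfold Nat.ModEq; omega⟩]
        · rw [if_neg h, if_neg (by unfold Nat.ModEq; omega), zero_mul]
      · intro j _ hj
        exact if_neg (by omega)
      · intro h
        exact absurd (Finset.mem_range.mpr (by omega)) h
  have h1 := key 1 le_rfl (by omega)
  rw [pow_one] at h1
  rw [← key 2 (by norm_num) (by omega), ← h1, pR, Finset.sum_filter, Finset.sum_product]
  simp only [Finset.sum_product]
  rw [← Finset.sum_add_distrib]
  refine Finset.sum_congr rfl fun i _ => ?_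
  rw [← Finset.sum_add_distrib]
  refine Finset.sum_congr rfl fun j _ => ?_
  rw [Finset.sum_pair (by norm_num)]
  simp only [pow_one]
  exact add_comm _ _

/-- The right side depends on `i` only mod 3. It could differ from the left only at monomials with
x-exponent outside [i, d+i]; those not already zero in O occur for d = 4Q-2 at i = 2Q-1 or i = 0,
and there the congruence fails because 3 does not divide Q. -/
theorem toO_mul_congrSum (hQ3 : Q % 3 ≠ 0) {d i : ℕ} (hd : 4 * Q ≤ d + 2) (hd' : d < 4 * Q)
    (hi : i < 2 * Q) :
    toO K Q (px K ^ i * py K ^ (2 * Q - 1 - i) * congrSum (px K) (py K) d) =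
      ∑ u ∈ Finset.range (8 * Q),
        if (u + 2 * i + d) % 3 = 0 then mon K Q u (d + 2 * Q - 1 - u) else 0 := by
  rw [congrSum, ← Finset.sum_filter, ← Finset.sum_filter, Finset.mul_sum, map_sum]
  refine Finset.sum_of_injOn (fun a => a + i) (fun a _ b _ h => Nat.add_right_cancel h) ?_ ?_ ?_
  · intro a ha
    simp only [Finset.coe_filter, Finset.mem_range, Set.mem_ofPred_eq] at ha ⊢
    omega
  · intro u hu hu'
    simp only [Finset.mem_filter, Finset.mem_range] at hu
    apply mon_eq_zero
    by_contra! hcon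
    have hiu : i ≤ u ∧ u ≤ d + i := by
      rcases (show d = 4 * Q - 1 ∨ d = 4 * Q - 2 by omega) with rfl | rfl
      · omega
      · constructor
        · by_contra! hlt
          obtain rfl : u = 2 * Q - 2 := by omega
          obtain rfl : i = 2 * Q - 1 := by omega
          omega
        · by_contra! hlt
          obtain rfl : u = 4 * Q - 1 := by omega
          obtain rfl : i = 0 := by omega
          omega
    refine hu' ⟨u - i, ?_, ?_⟩
    · simp only [Finset.coe_filter, Finset.mem_range, Set.mem_ofPred_eq]
      omega
    · dsimp only
      omega
  · intro a ha
    simp only [Finset.mem_filter, Finset.mem_range] at ha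
    rw [mon]
    congr 1
    rw [show d + 2 * Q - 1 - (a + i) = (2 * Q - 1 - i) + (d - a) by omega]
    ring

theorem toO_mul_pR_congr (hQ3 : Q % 3 ≠ 0) {i j : ℕ} (hi : i < 2 * Q) (hj : j < 2 * Q)
    (hij : i % 3 = j % 3) :
    toO K Q (px K ^ i * py K ^ (2 * Q - 1 - i) * pR K Q) =
      toO K Q (px K ^ j * py K ^ (2 * Q - 1 - j) * pR K Q) := by
  rw [pR_eq_congrSum (by omega), mul_add, mul_add, ← mul_assoc, ← mul_assoc, ← mul_assoc,
    ← mul_assoc]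
  simp only [map_add, map_mul (toO K Q) (_ * congrSum _ _ _)]
  rw [toO_mul_congrSum hQ3 (by omega) (by omega) hi, toO_mul_congrSum hQ3 (by omega) (by omega) hi,
    toO_mul_congrSum hQ3 (by omega) (by omega) hj, toO_mul_congrSum hQ3 (by omega) (by omega) hj]
  have h : ∀ u d, (u + 2 * i + d) % 3 = 0 ↔ (u + 2 * j + d) % 3 = 0 := fun u d => by omega
  simp only [h]

variable [CharP K 2]

/-- Only exponents mod 3 matter. If i ≡ 2Q-1, then 2i and 2Q-1-2i are congruent and the two terms
cancel; otherwise they are congruent to 1 and 2Q-2 in some order, which are the exponents in γ. -/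
theorem toO_pair_mul_pR (hQ3 : Q % 3 ≠ 0) {i : ℕ} (hi : i < Q) :
    toO K Q (px K ^ (2 * i) * py K ^ (2 * Q - 1 - 2 * i) * pR K Q) +
      toO K Q (px K ^ (2 * Q - 1 - 2 * i) * py K ^ (2 * Q - 1 - (2 * Q - 1 - 2 * i)) * pR K Q) =
    (if i % 3 = (2 * Q - 1) % 3 then 0 else 1 : K) •
      toO K Q ((px K ^ (2 * Q - 2) * py K + px K * py K ^ (2 * Q - 2)) * pR K Q) := by
  have hγ : toO K Q ((px K ^ (2 * Q - 2) * py K + px K * py K ^ (2 * Q - 2)) * pR K Q) =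
      toO K Q (px K ^ (2 * Q - 2) * py K ^ (2 * Q - 1 - (2 * Q - 2)) * pR K Q) +
      toO K Q (px K ^ 1 * py K ^ (2 * Q - 1 - 1) * pR K Q) := by
    rw [← map_add, ← add_mul, show 2 * Q - 1 - (2 * Q - 2) = 1 by omega, pow_one, pow_one,
      show 2 * Q - 1 - 1 = 2 * Q - 2 by omega]
  split_ifs with h
  · rw [zero_smul, toO_mul_pR_congr hQ3 (j := 2 * Q - 1 - 2 * i) (by omega) (by omega) (by omega),
      ← two_smul K, CharTwo.two_eq_zero, zero_smul]
  · rw [one_smul, hγ]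
    have hc : (2 * i % 3 = 1 ∧ (2 * Q - 1 - 2 * i) % 3 = (2 * Q - 2) % 3) ∨
        (2 * i % 3 = (2 * Q - 2) % 3 ∧ (2 * Q - 1 - 2 * i) % 3 = 1) := by
      obtain ⟨k, hk⟩ : ∃ k, Q = 3 * k + 1 ∨ Q = 3 * k + 2 := ⟨Q / 3, by omega⟩
      obtain ⟨l, hl⟩ : ∃ l, i = 3 * l ∨ i = 3 * l + 1 ∨ i = 3 * l + 2 := ⟨i / 3, by omega⟩
      rcases hk with rfl | rfl <;> rcases hl with rfl | rfl | rfl <;> omega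
    rcases hc with ⟨h1, h2⟩ | ⟨h1, h2⟩
    · rw [add_comm, toO_mul_pR_congr hQ3 (j := 2 * Q - 2) (i := 2 * Q - 1 - 2 * i)
        (by omega) (by omega) h2,
        toO_mul_pR_congr hQ3 (j := 1) (i := 2 * i) (by omega) (by omega) h1]
    · rw [toO_mul_pR_congr hQ3 (j := 1) (i := 2 * Q - 1 - 2 * i)
        (by omega) (by omega) h2,
        toO_mul_pR_congr hQ3 (j := 2 * Q - 2) (i := 2 * i) (by omega) (by omega) h1]

/-- Modulo `g W₀`, multiplication by `P` is multiplication by `A x ^ 2 y ^ 2`. -/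
theorem mul_pP_pow_sub_mem_gW₀ (A : K) {a b k : ℕ} (hk : k < Q) (h : a + b + 4 * k = 6 * Q - 1) :
    toO K Q (px K ^ a * py K ^ b * pP K ^ k) - A ^ k • mon K Q (a + 2 * k) (b + 2 * k)
      ∈ gW₀ Q A := by
  induction k generalizing a b with
  | zero => simp [mon]
  | succ k ih =>
    have h1 := ih (a := a + 2) (b := b + 2) (by omega) (by omega)
    have h2 : toO K Q (pg A) * toO K Q (px K ^ a * py K ^ b * pP K ^ k) ∈ gW₀ Q A :=
      Submodule.mem_map_of_mem (Submodule.subset_span ⟨a, b, k, by omega, by omega, rfl⟩)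
    have h3 : toO K Q (px K ^ a * py K ^ b * pP K ^ (k + 1)) =
        toO K Q (pg A) * toO K Q (px K ^ a * py K ^ b * pP K ^ k) +
          A • toO K Q (px K ^ (a + 2) * py K ^ (b + 2) * pP K ^ k) := by
      rw [← map_mul, ← toO_C_mul, ← map_add]
      congr 1
      rw [pg]
      linear_combination (-(MvPolynomial.C A * px K ^ (a + 2) * py K ^ (b + 2) * pP K ^ k)) *
        CharTwo.two_eq_zero (R := Poly K)
    rw [h3, show a + 2 * (k + 1) = a + 2 + 2 * k by ring,
      show b + 2 * (k + 1) = b + 2 + 2 * k by ring, pow_succ' A, mul_smul, add_sub_assoc,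
      ← smul_sub]
    exact add_mem h2 (Submodule.smul_mem _ _ h1)

omit [CharP K 2] in
-- Substitute 2Q + r' = r + 2qa + 2q. Then r - r' = 2q(t - a - 1), so the mod 3 condition on a
-- becomes divisibility by 6q; values of r' outside the range give monomials that vanish in O.
theorem sum_mon_reindex {q t r : ℕ} (hq : 0 < q) (ht : 0 < t) (hQ : Q = q * t) (hr : r < 2 * Q) :
    ∑ a ∈ Finset.range (2 * t - 2 + 1), (if (a + (2 * t - 2)) % 3 = 0 then
      mon K Q (r + 2 * q * a + 2 * q) (2 * Q - 1 - r + 2 * q * (2 * t - 2 - a) + 2 * q) else 0) =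
    ∑ r' ∈ Finset.range (2 * Q), (if ((6 * q : ℕ) : ℤ) ∣ (r : ℤ) - r' then
      mon K Q (2 * Q + r') (2 * Q + (2 * Q - 1 - r')) else 0) := by
  rw [← Finset.sum_filter, ← Finset.sum_filter]
  symm
  have hyp : ∀ a, a < 2 * t - 2 + 1 →
      2 * q * a + 2 * q * (2 * t - 2 - a) + 4 * q = 4 * Q := by
    intro a ha
    obtain ⟨b, hb⟩ : ∃ b, a + b + 2 = 2 * t := ⟨2 * t - 2 - a, by omega⟩
    rw [show 2 * t - 2 - a = b by omega, hQ, show 4 * (q * t) = 2 * q * (2 * t) by ring, ← hb]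
    ring
  have he : ∀ r', r' < 2 * Q → ((6 * q : ℕ) : ℤ) ∣ (r : ℤ) - r' →
      ∃ a, a < 2 * t - 2 + 1 ∧ (a + (2 * t - 2)) % 3 = 0 ∧ r + 2 * q * a + 2 * q = 2 * Q + r' := by
    rintro r' hr' ⟨w, hw⟩
    push_cast at hw
    have hQ' : (Q : ℤ) = q * t := by exact_mod_cast hQ
    have h1 : 0 < (t : ℤ) - 3 * w := by
      have : 0 < (2 * q : ℤ) * (t - 3 * w) := by nlinarith
      exact pos_of_mul_pos_right this (by positivity)
    have h2 : (t : ℤ) - 3 * w < 2 * t := by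
      have : (2 * q : ℤ) * (t - 3 * w) < 2 * q * (2 * t) := by nlinarith
      exact lt_of_mul_lt_mul_left this (by positivity)
    refine ⟨((t : ℤ) - 3 * w - 1).toNat, by omega, by omega, ?_⟩
    zify
    rw [Int.toNat_of_nonneg (by omega)]
    linear_combination (-2 : ℤ) * hQ' + hw
  choose! e he1 he2 he3 using he
  refine Finset.sum_of_injOn e ?_ ?_ ?_ ?_
  · intro a ha b hb hab
    simp only [Finset.coe_filter, Finset.mem_range, Set.mem_ofPred_eq] at ha hb
    have h1 := he3 a ha.1 ha.2
    have h2 := he3 b hb.1 hb.2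
    rw [hab] at h1
    omega
  · intro a ha
    simp only [Finset.coe_filter, Finset.mem_range, Set.mem_ofPred_eq] at ha ⊢
    exact ⟨he1 a ha.1 ha.2, he2 a ha.1 ha.2⟩
  · intro a ha ha'
    simp only [Finset.mem_filter, Finset.mem_range] at ha
    apply mon_eq_zero
    by_contra! hcon
    apply ha'
    have h1 := hyp a ha.1
    have hr' : r + 2 * q * a + 2 * q - 2 * Q < 2 * Q := by omega
    have hd : ((6 * q : ℕ) : ℤ) ∣ (r : ℤ) - (r + 2 * q * a + 2 * q - 2 * Q : ℕ) := by
      obtain ⟨w, hw⟩ : ∃ w : ℤ, (t : ℤ) - a - 1 = 3 * w := ⟨((t : ℤ) - a - 1) / 3, by omega⟩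
      refine ⟨w, ?_⟩
      have hQ' : (Q : ℤ) = q * t := by exact_mod_cast hQ
      rw [Nat.cast_sub (by omega)]
      push_cast
      linear_combination (2 * q : ℤ) * hw + 2 * hQ'
    refine ⟨r + 2 * q * a + 2 * q - 2 * Q, ?_, ?_⟩
    · simp only [Finset.coe_filter, Finset.mem_range, Set.mem_ofPred_eq]
      exact ⟨hr', hd⟩
    · have h2 := he3 _ hr' hd
      have h3 : 2 * q * e (r + 2 * q * a + 2 * q - 2 * Q) = 2 * q * a := by omega
      exact Nat.eq_of_mul_eq_mul_left (by positivity) h3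
  · intro a ha
    simp only [Finset.mem_filter, Finset.mem_range] at ha
    have h1 := he3 a ha.1 ha.2
    have h2 := hyp _ (he1 a ha.1 ha.2)
    congr 1 <;> omega

/-- The coefficient of `F_{r'}` in the product of `E_r` and `g`. -/
def multCoeff (A : K) (n r r' : ℕ) : K :=
  ∑ i ∈ Finset.range (n + 1), if ((6 * 2 ^ i : ℕ) : ℤ) ∣ (r : ℤ) - r' then A ^ 2 ^ i else 0

theorem pP_pow_two_pow (n : ℕ) :
    pP K ^ 2 ^ n = pz K ^ (4 * 2 ^ n) + pR K (2 ^ n) + ∑ i ∈ Finset.range n,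
      congrSum (px K) (py K) (2 * 2 ^ (n - i) - 2) ^ 2 ^ (i + 1) * pP K ^ 2 ^ i := by
  have h := pow_two_pow_expansion (x := px K) (y := py K) (z := pz K) (P := pP K) rfl (n + 1)
  have h4 : 2 ^ (n + 1 + 1) = 4 * 2 ^ n := by ring
  rw [h4, ← pR_eq_congrSum Nat.one_le_two_pow, Finset.sum_range_succ, Nat.add_sub_cancel_left] at h
  have h0 : congrSum (px K) (py K) (2 ^ 1 - 2) = 1 := by simp [congrSum]
  rw [h0, one_pow, one_mul] at h
  have hs : ∑ i ∈ Finset.range n,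
      congrSum (px K) (py K) (2 ^ (n + 1 - i) - 2) ^ 2 ^ (i + 1) * pP K ^ 2 ^ i =
      ∑ i ∈ Finset.range n,
      congrSum (px K) (py K) (2 * 2 ^ (n - i) - 2) ^ 2 ^ (i + 1) * pP K ^ 2 ^ i := by
    refine Finset.sum_congr rfl fun i hi => ?_
    rw [Finset.mem_range] at hi
    rw [show n + 1 - i = n - i + 1 by omega, pow_succ' 2 (n - i)]
  rw [hs] at h
  rw [h]
  linear_combination (-(pR K (2 ^ n) + ∑ i ∈ Finset.range n,
    congrSum (px K) (py K) (2 * 2 ^ (n - i) - 2) ^ 2 ^ (i + 1) * pP K ^ 2 ^ i)) *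
      CharTwo.two_eq_zero (R := Poly K)

theorem congrSum_mul_pP_sub_mem_gW₀ (A : K) {n i r : ℕ} (hi : i < n) (hr : r < 2 * 2 ^ n) :
    toO K (2 ^ n) (px K ^ r * py K ^ (2 * 2 ^ n - 1 - r) *
        (congrSum (px K) (py K) (2 * 2 ^ (n - i) - 2) ^ 2 ^ (i + 1) * pP K ^ 2 ^ i)) -
      A ^ 2 ^ i • ∑ r' ∈ Finset.range (2 * 2 ^ n), (if ((6 * 2 ^ i : ℕ) : ℤ) ∣ (r : ℤ) - r' then
        mon K (2 ^ n) (2 * 2 ^ n + r') (2 * 2 ^ n + (2 * 2 ^ n - 1 - r')) else 0)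
      ∈ gW₀ (2 ^ n) A := by
  have hQ : 2 ^ n = 2 ^ i * 2 ^ (n - i) := by rw [← pow_add]; congr 1; omega
  have hlt : 2 ^ i < 2 ^ n := Nat.pow_lt_pow_right (by norm_num) hi
  rw [← sum_mon_reindex (by positivity) (by positivity) hQ hr, congrSum_pow_two_pow,
    Finset.sum_mul, Finset.mul_sum, map_sum, Finset.smul_sum, ← Finset.sum_sub_distrib]
  refine Submodule.sum_mem _ fun a ha => ?_
  rw [Finset.mem_range] at ha
  split_ifs with h
  · have hyp : 2 ^ (i + 1) * a + 2 ^ (i + 1) * (2 * 2 ^ (n - i) - 2 - a) + 4 * 2 ^ i =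
        4 * 2 ^ n := by
      have ht := Nat.one_le_two_pow (n := n - i)
      obtain ⟨b, hb⟩ : ∃ b, a + b + 2 = 2 * 2 ^ (n - i) := ⟨2 * 2 ^ (n - i) - 2 - a, by omega⟩
      rw [show 2 * 2 ^ (n - i) - 2 - a = b by omega, hQ,
        show 4 * (2 ^ i * 2 ^ (n - i)) = 2 * 2 ^ i * (2 * 2 ^ (n - i)) by ring, ← hb]
      ring
    have hdeg : r + 2 ^ (i + 1) * a +
        (2 * 2 ^ n - 1 - r + 2 ^ (i + 1) * (2 * 2 ^ (n - i) - 2 - a)) + 4 * 2 ^ i =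
        6 * 2 ^ n - 1 := by
      clear hQ
      generalize 2 ^ (i + 1) * a = u at hyp ⊢
      generalize 2 ^ (i + 1) * (2 * 2 ^ (n - i) - 2 - a) = v at hyp ⊢
      omega
    have := mul_pP_pow_sub_mem_gW₀ A hlt hdeg
    rw [pow_succ' 2 i] at this ⊢
    convert this using 3
    ring
  · simp

/-- The product of `x ^ r * y ^ (2Q - 1 - r) * P ^ (Q - 1)` and `g`, modulo `g W₀`. -/
theorem mul_pg_sub_mem_gW₀ (A : K) {n r : ℕ} (hr : r < 2 * 2 ^ n) :
    toO K (2 ^ n) (px K ^ r * py K ^ (2 * 2 ^ n - 1 - r) * pP K ^ (2 ^ n - 1)) *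
        toO K (2 ^ n) (pg A) -
      (toO K (2 ^ n) (px K ^ r * py K ^ (2 * 2 ^ n - 1 - r) * pR K (2 ^ n)) +
        ∑ r' ∈ Finset.range (2 * 2 ^ n), multCoeff A n r r' •
          mon K (2 ^ n) (2 * 2 ^ n + r') (2 * 2 ^ n + (2 * 2 ^ n - 1 - r')))
      ∈ gW₀ (2 ^ n) A := by
  have h1 := Nat.one_le_two_pow (n := n)
  have e1 : toO K (2 ^ n) (px K ^ r * py K ^ (2 * 2 ^ n - 1 - r) * pP K ^ (2 ^ n - 1)) *
        toO K (2 ^ n) (pg A) =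
      toO K (2 ^ n) (px K ^ r * py K ^ (2 * 2 ^ n - 1 - r) * pR K (2 ^ n)) +
      ∑ i ∈ Finset.range n, toO K (2 ^ n) (px K ^ r * py K ^ (2 * 2 ^ n - 1 - r) *
        (congrSum (px K) (py K) (2 * 2 ^ (n - i) - 2) ^ 2 ^ (i + 1) * pP K ^ 2 ^ i)) +
      A • toO K (2 ^ n) (px K ^ (r + 2) * py K ^ (2 * 2 ^ n - 1 - r + 2) *
        pP K ^ (2 ^ n - 1)) := by
    have hz : toO K (2 ^ n) (pz K ^ (4 * 2 ^ n)) = 0 :=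
      toO_eq_zero_of_dvd (Or.inr (Or.inr rfl)) dvd_rfl
    have hp : px K ^ r * py K ^ (2 * 2 ^ n - 1 - r) * pP K ^ (2 ^ n - 1) * pg A =
        px K ^ r * py K ^ (2 * 2 ^ n - 1 - r) * pP K ^ 2 ^ n +
        MvPolynomial.C A * (px K ^ (r + 2) * py K ^ (2 * 2 ^ n - 1 - r + 2) *
          pP K ^ (2 ^ n - 1)) := by
      obtain ⟨m, hm⟩ : ∃ m, 2 ^ n = m + 1 := ⟨2 ^ n - 1, by omega⟩
      rw [pg, hm, Nat.add_sub_cancel]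
      ring
    rw [← map_mul, hp, map_add, toO_C_mul, pP_pow_two_pow, mul_add, mul_add, map_add, map_add,
      Finset.mul_sum, map_sum, map_mul _ _ (pz K ^ (4 * 2 ^ n)), hz, mul_zero, zero_add]
  have e2 : ∑ r' ∈ Finset.range (2 * 2 ^ n), multCoeff A n r r' •
          mon K (2 ^ n) (2 * 2 ^ n + r') (2 * 2 ^ n + (2 * 2 ^ n - 1 - r')) =
      ∑ i ∈ Finset.range n, A ^ 2 ^ i • ∑ r' ∈ Finset.range (2 * 2 ^ n),
        (if ((6 * 2 ^ i : ℕ) : ℤ) ∣ (r : ℤ) - r' then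
          mon K (2 ^ n) (2 * 2 ^ n + r') (2 * 2 ^ n + (2 * 2 ^ n - 1 - r')) else 0) +
      A ^ 2 ^ n • mon K (2 ^ n) (r + 2 * 2 ^ n) (2 * 2 ^ n - 1 - r + 2 * 2 ^ n) := by
    -- The term from A x²y² P^(Q-1) is the missing index i = n: with t = 1 the sum over r' has the
    -- single term r' = r, since 6Q divides no nonzero difference below 2Q.
    have h := sum_mon_reindex (K := K) (Q := 2 ^ n) (q := 2 ^ n) (t := 1) (by positivity)
      one_pos (by simp) hr
    simp only [Nat.mul_one, Nat.sub_self, zero_add, Finset.range_one, Finset.sum_singleton,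
      Nat.zero_mod, if_true, mul_zero, add_zero] at h
    rw [h, ← Finset.sum_range_succ (fun i => A ^ 2 ^ i • ∑ r' ∈ Finset.range (2 * 2 ^ n),
        (if ((6 * 2 ^ i : ℕ) : ℤ) ∣ (r : ℤ) - r' then
          mon K (2 ^ n) (2 * 2 ^ n + r') (2 * 2 ^ n + (2 * 2 ^ n - 1 - r')) else 0))]
    simp only [Finset.smul_sum, multCoeff, Finset.sum_smul]
    rw [Finset.sum_comm]
    refine Finset.sum_congr rfl fun i _ => Finset.sum_congr rfl fun r' _ => ?_
    rw [ite_smul, zero_smul, smul_ite, smul_zero]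
  have e3 := mul_pP_pow_sub_mem_gW₀ A (Q := 2 ^ n) (a := r + 2) (b := 2 * 2 ^ n - 1 - r + 2)
    (k := 2 ^ n - 1) (by omega) (by omega)
  rw [show r + 2 + 2 * (2 ^ n - 1) = r + 2 * 2 ^ n by omega,
    show 2 * 2 ^ n - 1 - r + 2 + 2 * (2 ^ n - 1) = 2 * 2 ^ n - 1 - r + 2 * 2 ^ n by omega] at e3
  have e4 := Submodule.sum_mem (gW₀ (2 ^ n) A) (t := Finset.range n)
    fun i hi => congrSum_mul_pP_sub_mem_gW₀ A (Finset.mem_range.mp hi) hr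
  rw [Finset.sum_sub_distrib] at e4
  have e5 := add_mem e4 (Submodule.smul_mem _ A e3)
  rw [e1, e2]
  convert e5 using 1
  rw [smul_sub, ← mul_smul, ← pow_succ' A, Nat.sub_add_cancel h1]
  abel

end TruncatedRing

end BrennerMonsky
end

noncomputable section
namespace BrennerMonsky

/-! ### Values of the linear forms on R, γ and multiples of s. -/

section Evaluation

open Polynomial

variable {K : Type*} [Field K] {Q : ℕ}

theorem remCoeff_mon [CharP K 2] (hQ : 1 ≤ Q) (A : K) {i j : ℕ} (hi : i < 4 * Q) (hj : j < 4 * Q)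
    (c a b : ℕ) :
    remCoeff Q A i j c hi hj (mon K Q a b) = if a = i ∧ b = j ∧ c = 0 then 1 else 0 := by
  rw [mon, remCoeff_toO, toTri_pg, toTri_monomial, mod_of_natDegree_lt_four _ _ _ hQ (by simp),
    triCoeff_apply, coeff_C]
  by_cases hc : c = 0
  · simp [hc, coeff_xy]
  · simp [hc]

theorem remCoeff_eq_zero_of_mem_gW₀ [CharP K 2] (A : K) {i j : ℕ} (hi : i < 4 * Q)
    (hj : j < 4 * Q) (c : ℕ) {u : O K Q} (hu : u ∈ gW₀ Q A) : remCoeff Q A i j c hi hj u = 0 := by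
  obtain ⟨w, hw, rfl⟩ := hu
  have : W₀ K Q ≤ LinearMap.ker
      ((remCoeff Q A i j c hi hj).comp (LinearMap.mulLeft K (toO K Q (pg A)))) := by
    refine Submodule.span_le.mpr ?_
    rintro _ ⟨a, b, k, h, hk, rfl⟩
    rw [SetLike.mem_coe, LinearMap.mem_ker, LinearMap.comp_apply, LinearMap.mulLeft_apply,
      ← map_mul, remCoeff_toO, map_mul, map_mul, map_pow, toTri_monomial, toTri_pg, toTri_pP,
      mod_mul_C_mul_quartic_pow _ _ _ _ (by omega), map_zero]
  exact this hw

theorem toTri_congrSum (d : ℕ) : toTri K (congrSum (px K) (py K) d) =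
    C (∑ a ∈ Finset.range (d + 1), if (a + d) % 3 = 0 then xy K a (d - a) else 0) := by
  rw [congrSum, map_sum, map_sum]
  refine Finset.sum_congr rfl fun a _ => ?_
  split_ifs
  · exact toTri_monomial a (d - a)
  · simp

theorem toTri_monomial_mul_pR (hQ : 1 ≤ Q) (i j : ℕ) :
    toTri K (px K ^ i * py K ^ j * pR K Q) =
      C (xy K i j * ∑ a ∈ Finset.range (4 * Q - 2 + 1),
        if (a + (4 * Q - 2)) % 3 = 0 then xy K a (4 * Q - 2 - a) else 0) * Polynomial.X ^ 2 +
      C (xy K i j * ∑ a ∈ Finset.range (4 * Q - 1 + 1),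
        if (a + (4 * Q - 1)) % 3 = 0 then xy K a (4 * Q - 1 - a) else 0) * Polynomial.X := by
  rw [pR_eq_congrSum hQ, map_mul, toTri_monomial, map_add, map_mul, map_mul, toTri_congrSum,
    toTri_congrSum, map_pow, toTri_pz, C_mul, C_mul]
  ring

theorem natDegree_toTri_monomial_mul_pR_lt (hQ : 1 ≤ Q) (i j : ℕ) :
    (toTri K (px K ^ i * py K ^ j * pR K Q)).natDegree < 4 := by
  rw [toTri_monomial_mul_pR hQ]
  refine lt_of_le_of_lt (b := 2) ?_ (by norm_num)
  compute_degree

theorem remCoeff_mul_pR_zero [CharP K 2] (hQ : 1 ≤ Q) (A : K) {i j : ℕ} (hi : i < 4 * Q)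
    (hj : j < 4 * Q) (a b : ℕ) :
    remCoeff Q A i j 0 hi hj (toO K Q (px K ^ a * py K ^ b * pR K Q)) = 0 := by
  rw [remCoeff_toO, toTri_pg, mod_of_natDegree_lt_four _ _ _ hQ
    (natDegree_toTri_monomial_mul_pR_lt hQ a b), toTri_monomial_mul_pR hQ, triCoeff_apply]
  simp

theorem remCoeff_mul_pR_one [CharP K 2] (hQ : 1 ≤ Q) (A : K) {i j a b : ℕ} (hi : i < 4 * Q)
    (hj : j < 4 * Q) (h : i + j = a + b + (4 * Q - 1)) :
    remCoeff Q A i j 1 hi hj (toO K Q (px K ^ a * py K ^ b * pR K Q)) =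
      if a ≤ i ∧ b ≤ j ∧ (i - a + (4 * Q - 1)) % 3 = 0 then 1 else 0 := by
  rw [remCoeff_toO, toTri_pg, mod_of_natDegree_lt_four _ _ _ hQ
    (natDegree_toTri_monomial_mul_pR_lt hQ a b), toTri_monomial_mul_pR hQ, triCoeff_apply,
    coeff_add, coeff_C_mul_X_pow, coeff_C_mul_X, if_neg (by norm_num), if_pos rfl, zero_add,
    coeff_xy_mul]
  by_cases hab : a ≤ i ∧ b ≤ j
  · rw [if_pos hab, finsetSum_coeff, finsetSum_coeff, Finset.sum_eq_single (i - a)]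
    · by_cases h3 : (i - a + (4 * Q - 1)) % 3 = 0
      · rw [if_pos h3, if_pos ⟨hab.1, hab.2, h3⟩, coeff_xy, if_pos ⟨rfl, by omega⟩]
      · rw [if_neg h3, if_neg (by tauto)]
        simp
    · intro u _ hu
      split_ifs
      · rw [coeff_xy, if_neg (by tauto)]
      · simp
    · intro hn
      exact absurd (Finset.mem_range.mpr (by omega)) hn
  · rw [if_neg hab, if_neg (by tauto)]

/-- The monomial x^(2Q-1) y^(4Q-1) z occurs in exactly one of the two summands of γ, again because 3
does not divide Q. -/
theorem remCoeff_γ [CharP K 2] (hQ : Q % 3 ≠ 0) (A : K)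
    (hi : 2 * Q - 1 < 4 * Q) (hj : 4 * Q - 1 < 4 * Q) :
    remCoeff Q A (2 * Q - 1) (4 * Q - 1) 1 hi hj
      (toO K Q ((px K ^ (2 * Q - 2) * py K + px K * py K ^ (2 * Q - 2)) * pR K Q)) = 1 := by
  have h1 := remCoeff_mul_pR_one (K := K) (Q := Q) (by omega) A (a := 2 * Q - 2) (b := 1) hi hj
    (by omega)
  have h2 := remCoeff_mul_pR_one (K := K) (Q := Q) (by omega) A (a := 1) (b := 2 * Q - 2) hi hj
    (by omega)
  rw [if_neg (by omega), pow_one] at h1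
  rw [if_pos (by omega), pow_one] at h2
  rw [add_mul, map_add, map_add, h1, h2, zero_add]

theorem remCoeff_γ_zero [CharP K 2] (hQ : 1 ≤ Q) (A : K) {i j : ℕ}
    (hi : i < 4 * Q) (hj : j < 4 * Q) :
    remCoeff Q A i j 0 hi hj
      (toO K Q ((px K ^ (2 * Q - 2) * py K + px K * py K ^ (2 * Q - 2)) * pR K Q)) = 0 := by
  have h1 := remCoeff_mul_pR_zero (K := K) hQ A hi hj (2 * Q - 2) 1
  have h2 := remCoeff_mul_pR_zero (K := K) hQ A hi hj 1 (2 * Q - 2)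
  rw [pow_one] at h1 h2
  rw [add_mul, map_add, map_add, h1, h2, zero_add]

theorem add_pow_two_pow_sub_one {S : Type*} [CommRing S] [IsDomain S] [CharP S 2] {u v : S}
    (h : u + v ≠ 0) (n : ℕ) :
    (u + v) ^ (2 ^ n - 1) = ∑ i ∈ Finset.range (2 ^ n), u ^ i * v ^ (2 ^ n - 1 - i) := by
  apply mul_right_cancel₀ h
  rw [← pow_succ, Nat.sub_add_cancel Nat.one_le_two_pow, add_pow_char_pow]
  have := (Commute.all u v).geom_sum₂_mul (2 ^ n)
  rw [CharTwo.sub_eq_add, CharTwo.sub_eq_add] at this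
  exact this.symm

/-- As s already carries z^(3Q), only z^(Q-1) in P^k counts; its coefficient is zero unless k = Q-1,
when it is (x³+y³)^(Q-1), the sum of all x^(3j) y^(3(Q-1-j)). The x-exponent then demands 3j =
4Q-2-a with j ≤ Q-1. -/
theorem socleCoeff_mul_elemS [CharP K 2] {n : ℕ} [NeZero (2 ^ n)] {a b k : ℕ}
    (h : a + b + 4 * k = 6 * 2 ^ n - 5) (hk : k ≤ 2 ^ n - 1) :
    socleCoeff K (2 ^ n) (toO K (2 ^ n) (px K ^ a * py K ^ b * pP K ^ k) * elemS K (2 ^ n)) =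
      if k = 2 ^ n - 1 ∧ 2 ^ n + 1 ≤ a ∧ a % 3 = (2 ^ n + 1) % 3 then 1 else 0 := by
  have h1 := Nat.one_le_two_pow (n := n)
  have ht : toTri K (px K ^ a * py K ^ b * pP K ^ k * (px K * py K * pf K ^ 2 ^ n)) =
      C (xy K (a + 1) (b + 1 + 3 * 2 ^ n)) * (toTri K (pP K) ^ k * Polynomial.X ^ (3 * 2 ^ n)) := by
    simp only [pf, xy, map_mul, map_pow, toTri_px, toTri_py, toTri_pz, mul_pow, ← pow_mul]
    ring
  rw [elemS, ← map_mul, socleCoeff_toO, ht, triCoeff_apply, coeff_C_mul, coeff_mul_X_pow',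
    if_pos (by omega), show 4 * 2 ^ n - 1 - 3 * 2 ^ n = 2 ^ n - 1 by omega, toTri_pP,
    coeff_quartic_pow _ _ _ _ (by omega)]
  by_cases hk' : k = 2 ^ n - 1
  · have hne : (C (Polynomial.X ^ 3) + Polynomial.X ^ 3 : K[X][X]) ≠ 0 := by
      rw [add_comm]
      exact X_pow_add_C_ne_zero (by norm_num) _
    have hsum : ∀ j, (C (Polynomial.X ^ 3) : K[X][X]) ^ j *
        (Polynomial.X ^ 3) ^ (2 ^ n - 1 - j) = xy K (3 * j) (3 * (2 ^ n - 1 - j)) := by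
      intro j
      rw [xy, ← C_pow, ← pow_mul, ← pow_mul]
    rw [if_pos hk', ← C_pow, add_pow_two_pow_sub_one hne]
    simp only [hsum]
    rw [Finset.mul_sum, finsetSum_coeff, finsetSum_coeff]
    simp only [xy_mul, coeff_xy]
    by_cases hc : 2 ^ n + 1 ≤ a ∧ a % 3 = (2 ^ n + 1) % 3
    · rw [if_pos ⟨hk', hc⟩, Finset.sum_eq_single ((4 * 2 ^ n - 2 - a) / 3)]
      · rw [if_pos]
        omega
      · intro j _ hj
        exact if_neg (by omega)
      · intro hn
        exact absurd (Finset.mem_range.mpr (by omega)) hn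
    · rw [if_neg (by tauto)]
      refine Finset.sum_eq_zero fun j hj => if_neg ?_
      rw [Finset.mem_range] at hj
      omega
  · rw [if_neg hk', if_neg (by tauto)]
    simp

/-- Both exponents satisfy the congruence exactly when i ≡ 2Q-1. As they add up to 2Q-1, at most one
reaches Q+1; neither would only if 2i = Q, or 2i = Q-1, and the congruence excludes both. -/
theorem socleCoeff_pair [CharP K 2] {n : ℕ} [NeZero (2 ^ n)] {i : ℕ} (hn : 1 ≤ n)
    (hi : i < 2 ^ n) :
    socleCoeff K (2 ^ n) ((toO K (2 ^ n) (px K ^ (2 * i) * py K ^ (2 * 2 ^ n - 1 - 2 * i) *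
        pP K ^ (2 ^ n - 1)) +
      toO K (2 ^ n) (px K ^ (2 * 2 ^ n - 1 - 2 * i) *
        py K ^ (2 * 2 ^ n - 1 - (2 * 2 ^ n - 1 - 2 * i)) * pP K ^ (2 ^ n - 1))) *
      elemS K (2 ^ n)) = if i % 3 = (2 * 2 ^ n - 1) % 3 then 1 else 0 := by
  have h6 := two_pow_mod_six hn
  rw [add_mul, map_add, socleCoeff_mul_elemS (by omega) le_rfl,
    socleCoeff_mul_elemS (by omega) le_rfl]
  generalize 2 ^ n = Q at *
  simp only [true_and]
  have h1 : (2 * i % 3 = (Q + 1) % 3 ↔ i % 3 = (2 * Q - 1) % 3) ∧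
      ((2 * Q - 1 - 2 * i) % 3 = (Q + 1) % 3 ↔ i % 3 = (2 * Q - 1) % 3) := by
    obtain ⟨k, rfl | rfl⟩ : ∃ k, Q = 6 * k + 2 ∨ Q = 6 * k + 4 := ⟨Q / 6, by omega⟩ <;> omega
  simp only [h1.1, h1.2]
  by_cases h : i % 3 = (2 * Q - 1) % 3
  · by_cases hc : Q + 1 ≤ 2 * i
    · rw [if_pos ⟨hc, h⟩, if_neg (by omega), if_pos h, add_zero]
    · have hi2 : 2 * i ≠ Q := by
        have := h1.1.mpr h
        omega
      rw [if_neg (by tauto), if_pos (by omega), if_pos h, zero_add]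
  · rw [if_neg (by tauto), if_neg (by tauto), if_neg h, add_zero]

/-- A monomial of degree 12Q-3 with all exponents below 4Q must have all three equal to 4Q-1. -/
theorem eq_zero_of_socleCoeff_eq_zero [NeZero Q] {w : O K Q}
    (hw : w ∈ component K Q (12 * Q - 3)) (h : socleCoeff K Q w = 0) : w = 0 := by
  have hQ := NeZero.pos Q
  obtain ⟨p, hp, rfl⟩ := hw
  suffices hs : toO K Q p = socleCoeff K Q (toO K Q p) •
      toO K Q (px K ^ (4 * Q - 1) * py K ^ (4 * Q - 1) * pz K ^ (4 * Q - 1)) by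
    change toO K Q p = 0
    rw [hs]
    rw [AlgHom.toLinearMap_apply] at h
    rw [h, zero_smul]
  rw [← MvPolynomial.support_sum_monomial_coeff p]
  simp only [map_sum, Finset.sum_smul]
  refine Finset.sum_congr rfl fun d hd => ?_
  have hdeg : d 0 + d 1 + d 2 = 12 * Q - 3 := by
    have := MvPolynomial.IsHomogeneous.degree_eq_sum_deg_support
      ((MvPolynomial.mem_homogeneousSubmodule _ _).mp hp) hd
    rw [this, ← Fin.sum_univ_three]
    exact (Finset.sum_subset (Finset.subset_univ _) (by simp)).symm
  have hm : MvPolynomial.monomial d (p.coeff d) =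
      MvPolynomial.C (p.coeff d) * (px K ^ d 0 * py K ^ d 1 * pz K ^ d 2) := by
    rw [MvPolynomial.monomial_eq, Finsupp.prod_fintype _ _ (by simp), Fin.prod_univ_three]
    rfl
  rw [hm, toO_C_mul, map_smul, smul_assoc]
  congr 1
  by_cases hb : d 0 < 4 * Q ∧ d 1 < 4 * Q ∧ d 2 < 4 * Q
  · rw [show d 0 = 4 * Q - 1 by omega, show d 1 = 4 * Q - 1 by omega,
      show d 2 = 4 * Q - 1 by omega, socleCoeff_toO, map_mul (toTri K), toTri_monomial, map_pow (toTri K), toTri_pz,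
      triCoeff_apply, coeff_C_mul_X_pow, if_pos rfl, coeff_xy, if_pos ⟨rfl, rfl⟩, one_smul]
  · have h0 : toO K Q (px K ^ d 0 * py K ^ d 1 * pz K ^ d 2) = 0 := by
      by_cases hb0 : 4 * Q ≤ d 0
      · exact toO_eq_zero_of_dvd (Or.inl rfl) (((pow_dvd_pow _ hb0).mul_right _).mul_right _)
      · by_cases hb1 : 4 * Q ≤ d 1
        · exact toO_eq_zero_of_dvd (Or.inr (Or.inl rfl))
            (((pow_dvd_pow _ hb1).mul_left _).mul_right _)
        · exact toO_eq_zero_of_dvd (Or.inr (Or.inr rfl))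
            ((pow_dvd_pow _ (by omega : 4 * Q ≤ d 2)).mul_left _)
    rw [h0, map_zero, zero_smul]

theorem isHomogeneous_px : (px K).IsHomogeneous 1 := MvPolynomial.isHomogeneous_X _ _
theorem isHomogeneous_py : (py K).IsHomogeneous 1 := MvPolynomial.isHomogeneous_X _ _
theorem isHomogeneous_pz : (pz K).IsHomogeneous 1 := MvPolynomial.isHomogeneous_X _ _

theorem isHomogeneous_pP : (pP K).IsHomogeneous 4 := by
  refine (((isHomogeneous_pz.pow 4).add ?_).add ?_).add ?_
  · exact (isHomogeneous_px.mul isHomogeneous_py).mul (isHomogeneous_pz.pow 2)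
  · exact (isHomogeneous_px.pow 3).mul isHomogeneous_pz
  · exact (isHomogeneous_py.pow 3).mul isHomogeneous_pz

theorem isHomogeneous_monomial_mul_pP_pow (a b k : ℕ) :
    (px K ^ a * py K ^ b * pP K ^ k).IsHomogeneous (a + b + 4 * k) := by
  have := ((isHomogeneous_px (K := K).pow a).mul (isHomogeneous_py.pow b)).mul
    (isHomogeneous_pP.pow k)
  simpa only [one_mul] using this

theorem isHomogeneous_elemS (Q : ℕ) : (px K * py K * pf K ^ Q).IsHomogeneous (6 * Q + 2) := by
  have hf : (pf K).IsHomogeneous 6 := (isHomogeneous_py.pow 3).mul (isHomogeneous_pz.pow 3)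
  have := (isHomogeneous_px.mul isHomogeneous_py).mul (hf.pow Q)
  rwa [add_comm] at this

theorem mul_elemS_mem_component (hQ : 1 ≤ Q) {u : O K Q} (hu : u ∈ W K Q) :
    u * elemS K Q ∈ component K Q (12 * Q - 3) := by
  have : W K Q ≤ (component K Q (12 * Q - 3)).comap (LinearMap.mulRight K (elemS K Q)) := by
    refine Submodule.span_le.mpr ?_
    rintro _ ⟨a, b, k, h, -, rfl⟩
    refine ⟨px K ^ a * py K ^ b * pP K ^ k * (px K * py K * pf K ^ Q), ?_, ?_⟩
    · rw [SetLike.mem_coe, MvPolynomial.mem_homogeneousSubmodule]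
      have := (isHomogeneous_monomial_mul_pP_pow (K := K) a b k).mul (isHomogeneous_elemS Q)
      rwa [h, show 6 * Q - 5 + (6 * Q + 2) = 12 * Q - 3 by omega] at this
    · rw [AlgHom.toLinearMap_apply, map_mul]
      rfl
  exact this hu

theorem mul_elemS_eq_zero_of_mem_W₀ [CharP K 2] {n : ℕ} {u : O K (2 ^ n)}
    (hu : u ∈ W₀ K (2 ^ n)) : u * elemS K (2 ^ n) = 0 := by
  have : W₀ K (2 ^ n) ≤ LinearMap.ker (LinearMap.mulRight K (elemS K (2 ^ n))) := by
    refine Submodule.span_le.mpr ?_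
    rintro _ ⟨a, b, k, h, hk, rfl⟩
    rw [SetLike.mem_coe, LinearMap.mem_ker, LinearMap.mulRight_apply]
    refine eq_zero_of_socleCoeff_eq_zero (mul_elemS_mem_component Nat.one_le_two_pow
      (Submodule.subset_span ⟨a, b, k, h, hk.le, rfl⟩)) ?_
    rw [socleCoeff_mul_elemS h hk.le, if_neg (by omega)]
  exact this hu

theorem multCoeff_eq_specialEntry [CharP K 2] {A β : K} (hA : β ^ 2 + β = A) {n : ℕ}
    (hβ : β ^ 2 ^ (n + 1) = β) (c : ℕ → K) (hc : ∀ e < n, c e = β ^ 2 ^ (e + 1) + β) {i j : ℕ}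
    (hi : i < 2 ^ n) (hj : j < 2 ^ n) :
    multCoeff A n (2 * i) (2 * j) = specialEntry c j i := by
  have hdvd : ∀ k, ((6 * 2 ^ k : ℕ) : ℤ) ∣ ((2 * i : ℕ) : ℤ) - (2 * j : ℕ) ↔
      (3 : ℤ) * 2 ^ k ∣ (j : ℤ) - i := by
    intro k
    rw [dvd_sub_comm]
    push_cast
    rw [← mul_sub, show (6 : ℤ) * 2 ^ k = 2 * (3 * 2 ^ k) by ring]
    exact mul_dvd_mul_iff_left (by norm_num)
  simp only [multCoeff, hdvd]
  unfold specialEntry ultraEntry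
  by_cases h3 : j % 3 = i % 3
  · rw [if_pos h3]
    by_cases hij : j = i
    · subst hij
      simp only [sub_self, dvd_zero, if_true]
      rw [sum_pow_two_pow hA, hβ, CharTwo.add_self_eq_zero]
    · rw [if_neg hij]
      have hd : (j : ℤ) - i ≠ 0 := by omega
      set e := padicValInt 2 ((j : ℤ) - i) with he
      -- As i ≡ j mod 3, only the powers of 2 matter: the sum runs over k ≤ e and telescopes to
      -- β^(2^(e+1)) + β.
      have hek : ∀ k, (3 : ℤ) * 2 ^ k ∣ (j : ℤ) - i ↔ k < e + 1 := by
        intro k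
        have h2 := padicValInt_dvd_iff (p := 2) k ((j : ℤ) - i)
        push_cast at h2
        rw [Nat.lt_succ_iff]
        constructor
        · intro h
          exact (h2.mp (dvd_of_mul_left_dvd h)).resolve_left hd
        · intro h
          refine IsCoprime.mul_dvd ?_ (by omega) (h2.mpr (Or.inr h))
          exact IsCoprime.pow_right (by norm_num)
      have hen : e < n := by
        by_contra! hne
        have := dvd_of_mul_left_dvd ((hek n).mpr (by omega))
        have hle := Int.le_of_dvd (abs_pos.mpr hd) ((dvd_abs _ _).mpr this)
        have hlt : |(j : ℤ) - i| < 2 ^ n := by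
          rw [abs_lt]
          have hi' : (i : ℤ) < 2 ^ n := by exact_mod_cast hi
          have hj' : (j : ℤ) < 2 ^ n := by exact_mod_cast hj
          omega
        omega
      simp only [hek]
      rw [hc e hen, ← sum_pow_two_pow hA, ← Finset.sum_filter]
      congr 1
      ext k
      simp only [Finset.mem_filter, Finset.mem_range]
      omega
  · rw [if_neg h3]
    refine Finset.sum_eq_zero fun k _ => if_neg fun h => h3 ?_
    have := dvd_of_mul_right_dvd h
    omega

end Evaluation

end BrennerMonsky
end

noncomputable section
namespace BrennerMonsky

theorem sum_range_two_mul_reflect {M : Type*} [AddCommMonoid M] (f : ℕ → M) (Q : ℕ) :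
    ∑ r ∈ Finset.range (2 * Q), f r =
      ∑ i ∈ Finset.range Q, (f (2 * i) + f (2 * Q - 1 - 2 * i)) := by
  rw [sum_range_even_odd, show (2 * Q + 1) / 2 = Q by omega, show 2 * Q / 2 = Q by omega,
    Finset.sum_add_distrib, ← Finset.sum_range_reflect (fun a => f (2 * a + 1))]
  congr 1
  refine Finset.sum_congr rfl fun i hi => ?_
  rw [Finset.mem_range] at hi
  congr 1
  omega

/-! ### The induced map, its matrix, and nonmembership of s. -/

section InducedMap

variable {K : Type*} [Field K] [CharP K 2] {n : ℕ}

omit [CharP K 2] in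
theorem multCoeff_reflect_right (A : K) {i j : ℕ} (hj : j < 2 ^ n) :
    multCoeff A n (2 * i) (2 * 2 ^ n - 1 - 2 * j) = 0 := by
  refine Finset.sum_eq_zero fun k _ => if_neg fun h => ?_
  push_cast at h
  have h2 : (2 : ℤ) ∣ 6 * 2 ^ k := ⟨3 * 2 ^ k, by ring⟩
  have := h2.trans h
  omega

omit [CharP K 2] in
theorem multCoeff_reflect_left (A : K) {i j : ℕ} (hi : i < 2 ^ n) :
    multCoeff A n (2 * 2 ^ n - 1 - 2 * i) (2 * j) = 0 := by
  refine Finset.sum_eq_zero fun k _ => if_neg fun h => ?_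
  push_cast at h
  have h2 : (2 : ℤ) ∣ 6 * 2 ^ k := ⟨3 * 2 ^ k, by ring⟩
  have := h2.trans h
  omega

omit [CharP K 2] in
theorem multCoeff_reflect (A : K) {i j : ℕ} (hi : i < 2 ^ n) (hj : j < 2 ^ n) :
    multCoeff A n (2 * 2 ^ n - 1 - 2 * i) (2 * 2 ^ n - 1 - 2 * j) =
      multCoeff A n (2 * i) (2 * j) := by
  refine Finset.sum_congr rfl fun k _ => ?_
  rw [show ((2 * 2 ^ n - 1 - 2 * i : ℕ) : ℤ) - (2 * 2 ^ n - 1 - 2 * j : ℕ) =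
    ((2 * j : ℕ) : ℤ) - (2 * i : ℕ) by omega]
  congr 1
  rw [dvd_sub_comm]

omit [CharP K 2] in
theorem gW₀_le_W' (Q : ℕ) (A : K) : gW₀ Q A ≤ W' K Q := by
  rw [gW₀, Submodule.map_le_iff_le_comap]
  refine Submodule.span_le.mpr ?_
  rintro _ ⟨a, b, k, h, hk, rfl⟩
  have e : toO K Q (pg A) * toO K Q (px K ^ a * py K ^ b * pP K ^ k) =
      toO K Q (px K ^ a * py K ^ b * pP K ^ (k + 1)) +
        A • toO K Q (px K ^ (a + 2) * py K ^ (b + 2) * pP K ^ k) := by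
    rw [← map_mul, ← toO_C_mul, ← map_add, pg]
    congr 1
    ring
  rw [SetLike.mem_coe, Submodule.mem_comap, LinearMap.mulLeft_apply, e]
  exact Submodule.mem_sup_right (add_mem
    (Submodule.subset_span ⟨a, b, k + 1, by omega, by omega, rfl⟩)
    (Submodule.smul_mem _ _ (Submodule.subset_span ⟨a + 2, b + 2, k, by omega, by omega, rfl⟩)))

theorem mul_pg_mem_W' (A : K) {u : O K (2 ^ n)} (hu : u ∈ W K (2 ^ n)) :
    u * toO K (2 ^ n) (pg A) ∈ W' K (2 ^ n) := by
  have h1 := Nat.one_le_two_pow (n := n)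
  have : W K (2 ^ n) ≤ (W' K (2 ^ n)).comap (LinearMap.mulRight K (toO K (2 ^ n) (pg A))) := by
    refine Submodule.span_le.mpr ?_
    rintro _ ⟨a, b, k, h, hk, rfl⟩
    rw [SetLike.mem_coe, Submodule.mem_comap, LinearMap.mulRight_apply]
    rcases hk.lt_or_eq with hk | rfl
    · rw [mul_comm (toO K (2 ^ n) _)]
      exact gW₀_le_W' _ A (Submodule.mem_map_of_mem (Submodule.subset_span ⟨a, b, k, h, hk, rfl⟩))
    · obtain rfl : b = 2 * 2 ^ n - 1 - a := by omega
      rw [← sub_add_cancel (toO K (2 ^ n) _ * _) _]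
      refine add_mem (gW₀_le_W' _ A (mul_pg_sub_mem_gW₀ A (r := a) (by omega))) (add_mem
        (Submodule.mem_sup_left (Submodule.subset_span ⟨a, _, by omega, rfl⟩))
        (Submodule.sum_mem _ fun r' hr' => Submodule.smul_mem _ _ (Submodule.mem_sup_right
          (Submodule.subset_span ⟨2 * 2 ^ n + r', 2 * 2 ^ n + (2 * 2 ^ n - 1 - r'), 0, ?_, by omega,
            by rw [pow_zero, mul_one]; rfl⟩))))
      rw [Finset.mem_range] at hr'
      omega
  exact this hu

/-- Multiplication by `g`, as a map `W / W₀ → W' / g W₀`. -/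
def mulG (n : ℕ) (A : K) : WQuot K (2 ^ n) →ₗ[K] W'Quot (2 ^ n) A :=
  Submodule.mapQ _ _ (LinearMap.restrict (LinearMap.mulRight K (toO K (2 ^ n) (pg A)))
    (fun _ hu => mul_pg_mem_W' A hu)) (fun u hu => by
      change (u : O K (2 ^ n)) * toO K (2 ^ n) (pg A) ∈ gW₀ (2 ^ n) A
      rw [mul_comm (u : O K (2 ^ n))]
      exact Submodule.mem_map_of_mem hu)

theorem mulG_classW (A : K) (u : W K (2 ^ n)) :
    mulG n A (classW u) =
      classW' A ⟨(u : O K (2 ^ n)) * toO K (2 ^ n) (pg A), mul_pg_mem_W' A u.2⟩ := rfl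

/-- Multiplication by `s`, as a map `W / W₀ → O_{12Q-3}`. -/
def mulS (K : Type*) [Field K] [CharP K 2] (n : ℕ) :
    WQuot K (2 ^ n) →ₗ[K] component K (2 ^ n) (12 * 2 ^ n - 3) :=
  Submodule.liftQ _ (LinearMap.restrict (LinearMap.mulRight K (elemS K (2 ^ n)))
    (fun _ hu => mul_elemS_mem_component Nat.one_le_two_pow hu)) (fun _ hu =>
      Subtype.ext (mul_elemS_eq_zero_of_mem_W₀ hu))

theorem mulS_classW (u : W K (2 ^ n)) :
    (mulS K n (classW u) : O K (2 ^ n)) = (u : O K (2 ^ n)) * elemS K (2 ^ n) := rfl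

/-- The representative of `G_i` in `W`. -/
def repG (K : Type*) [Field K] (Q : ℕ) (i : Fin Q) : W K Q :=
  ⟨toO K Q (px K ^ (2 * (i : ℕ)) * py K ^ (2 * Q - 1 - 2 * i) * pP K ^ (Q - 1)) +
    toO K Q (px K ^ (2 * Q - 1 - 2 * (i : ℕ)) * py K ^ (2 * Q - 1 - (2 * Q - 1 - 2 * i)) *
      pP K ^ (Q - 1)),
    add_mem (Submodule.subset_span ⟨_, _, _, by have := i.2; omega, le_rfl, rfl⟩)
      (Submodule.subset_span ⟨_, _, _, by have := i.2; omega, le_rfl, rfl⟩)⟩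

omit [CharP K 2] in
theorem classW_repG {Q : ℕ} (i : Fin Q) : classW (repG K Q i) = G K Q i := rfl

/-- The linear form on `W' / g W₀` induced by `remCoeff`. -/
def remCoeffQuot {Q : ℕ} (A : K) (i j c : ℕ) (hi : i < 4 * Q) (hj : j < 4 * Q) :
    W'Quot Q A →ₗ[K] K :=
  Submodule.liftQ _ ((remCoeff Q A i j c hi hj).comp (W' K Q).subtype)
    (fun _ hu => remCoeff_eq_zero_of_mem_gW₀ A hi hj c hu)

theorem remCoeffQuot_classW' {Q : ℕ} (A : K) (i j c : ℕ) (hi : i < 4 * Q) (hj : j < 4 * Q)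
    (v : W' K Q) : remCoeffQuot A i j c hi hj (classW' A v) = remCoeff Q A i j c hi hj v := rfl

theorem remCoeffQuot_H {Q : ℕ} (A : K) (a b c : ℕ) (ha : a < 4 * Q) (hb : b < 4 * Q)
    (j : Fin Q) : remCoeffQuot A a b c ha hb (H Q A j) =
      (if 2 * Q + 2 * (j : ℕ) = a ∧ 2 * Q + (2 * Q - 1 - 2 * j) = b ∧ c = 0 then 1 else 0) +
      if 2 * Q + (2 * Q - 1 - 2 * (j : ℕ)) = a ∧
        2 * Q + (2 * Q - 1 - (2 * Q - 1 - 2 * j)) = b ∧ c = 0 then 1 else 0 := by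
  have hQ : 1 ≤ Q := by have := j.2; omega
  rw [H, map_add, ← remCoeff_mon hQ A ha hb, ← remCoeff_mon hQ A ha hb]
  rfl

variable [NeZero (2 ^ n)]

theorem mulG_G (A : K) (i : Fin (2 ^ n)) (hn : 1 ≤ n) : mulG n A (G K (2 ^ n) i) =
    (if (i : ℕ) % 3 = (2 * 2 ^ n - 1) % 3 then 0 else 1 : K) • γ (2 ^ n) A +
      ∑ j : Fin (2 ^ n), multCoeff A n (2 * i) (2 * j) • H (2 ^ n) A j := by
  have hi := i.2
  have h6 := two_pow_mod_six hn
  let repH (j : Fin (2 ^ n)) : W' K (2 ^ n) :=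
    ⟨mon K (2 ^ n) (2 * 2 ^ n + 2 * j) (2 * 2 ^ n + (2 * 2 ^ n - 1 - 2 * j)) +
      mon K (2 ^ n) (2 * 2 ^ n + (2 * 2 ^ n - 1 - 2 * j))
        (2 * 2 ^ n + (2 * 2 ^ n - 1 - (2 * 2 ^ n - 1 - 2 * j))), by
      have := j.2
      exact Submodule.mem_sup_right (add_mem
        (Submodule.subset_span ⟨2 * 2 ^ n + 2 * j, 2 * 2 ^ n + (2 * 2 ^ n - 1 - 2 * j), 0,
          by omega, Nat.zero_le _, by rw [pow_zero, mul_one]; rfl⟩)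
        (Submodule.subset_span ⟨2 * 2 ^ n + (2 * 2 ^ n - 1 - 2 * j),
          2 * 2 ^ n + (2 * 2 ^ n - 1 - (2 * 2 ^ n - 1 - 2 * j)), 0,
          by omega, Nat.zero_le _, by rw [pow_zero, mul_one]; rfl⟩))⟩
  have hH : ∀ j, H (2 ^ n) A j = classW' A (repH j) := fun j => rfl
  have h1 := mul_pg_sub_mem_gW₀ A (n := n) (r := 2 * i) (by omega)
  have h2 := mul_pg_sub_mem_gW₀ A (n := n) (r := 2 * 2 ^ n - 1 - 2 * i) (by omega)
  rw [sum_range_two_mul_reflect, Finset.sum_range] at h1 h2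
  have e1 : ∑ j : Fin (2 ^ n), (multCoeff A n (2 * i) (2 * j) •
        mon K (2 ^ n) (2 * 2 ^ n + 2 * j) (2 * 2 ^ n + (2 * 2 ^ n - 1 - 2 * j)) +
      multCoeff A n (2 * i) (2 * 2 ^ n - 1 - 2 * j) •
        mon K (2 ^ n) (2 * 2 ^ n + (2 * 2 ^ n - 1 - 2 * j))
          (2 * 2 ^ n + (2 * 2 ^ n - 1 - (2 * 2 ^ n - 1 - 2 * j)))) +
      ∑ j : Fin (2 ^ n), (multCoeff A n (2 * 2 ^ n - 1 - 2 * i) (2 * j) •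
        mon K (2 ^ n) (2 * 2 ^ n + 2 * j) (2 * 2 ^ n + (2 * 2 ^ n - 1 - 2 * j)) +
      multCoeff A n (2 * 2 ^ n - 1 - 2 * i) (2 * 2 ^ n - 1 - 2 * j) •
        mon K (2 ^ n) (2 * 2 ^ n + (2 * 2 ^ n - 1 - 2 * j))
          (2 * 2 ^ n + (2 * 2 ^ n - 1 - (2 * 2 ^ n - 1 - 2 * j)))) =
      ∑ j : Fin (2 ^ n), multCoeff A n (2 * i) (2 * j) • (repH j : O K (2 ^ n)) := by
    rw [← Finset.sum_add_distrib]
    refine Finset.sum_congr rfl fun j _ => ?_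
    rw [multCoeff_reflect_right A j.2, multCoeff_reflect_left A hi, multCoeff_reflect A hi j.2,
      zero_smul, zero_smul, add_zero, zero_add, ← smul_add]
  have h3 := add_mem h1 h2
  rw [← add_sub_add_comm, add_add_add_comm, toO_pair_mul_pR (by omega) hi, e1, ← add_mul] at h3
  let repγ : W' K (2 ^ n) := ⟨toO K (2 ^ n) ((px K ^ (2 * 2 ^ n - 2) * py K +
    px K * py K ^ (2 * 2 ^ n - 2)) * pR K (2 ^ n)), by
      rw [add_mul, map_add]
      exact Submodule.mem_sup_left (Submodule.add_mem _
        (Submodule.subset_span ⟨2 * 2 ^ n - 2, 1, by omega, by rw [pow_one]⟩)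
        (Submodule.subset_span ⟨1, 2 * 2 ^ n - 2, by omega, by rw [pow_one]⟩))⟩
  have hγ : γ (2 ^ n) A = classW' A repγ := rfl
  have e2 : (if (i : ℕ) % 3 = (2 * 2 ^ n - 1) % 3 then 0 else 1 : K) • γ (2 ^ n) A +
      ∑ j : Fin (2 ^ n), multCoeff A n (2 * i) (2 * j) • H (2 ^ n) A j =
      classW' A ((if (i : ℕ) % 3 = (2 * 2 ^ n - 1) % 3 then 0 else 1 : K) • repγ +
        ∑ j : Fin (2 ^ n), multCoeff A n (2 * i) (2 * j) • repH j) := by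
    change _ = Submodule.mkQ _ _
    rw [map_add, map_smul, map_sum]
    simp only [map_smul, hH, hγ]
    rfl
  rw [e2, ← classW_repG, mulG_classW]
  refine (Submodule.Quotient.eq _).mpr ?_
  change (W' K (2 ^ n)).subtype _ ∈ gW₀ (2 ^ n) A
  rw [map_sub, map_add, map_sum]
  simp only [map_smul]
  exact h3

/-- The matrix of multiplication by `g` on combinations of the `G_i`. -/
theorem mulG_sum_G (A : K) (hn : 1 ≤ n) (w : ℕ → K) :
    mulG n A (∑ i : Fin (2 ^ n), w i • G K (2 ^ n) i) =
      (∑ i ∈ Finset.range (2 ^ n), if i % 3 = (2 * 2 ^ n - 1) % 3 then 0 else w i) •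
          γ (2 ^ n) A +
        ∑ j : Fin (2 ^ n), (∑ i ∈ Finset.range (2 ^ n), multCoeff A n (2 * i) (2 * j) * w i) •
          H (2 ^ n) A j := by
  simp only [map_sum, map_smul, mulG_G A _ hn, smul_add, Finset.sum_add_distrib, Finset.sum_range,
    Finset.sum_smul, Finset.smul_sum, ← mul_smul]
  refine congrArg₂ (· + ·) ?_ ?_
  · refine Finset.sum_congr rfl fun i _ => ?_
    rw [mul_ite, mul_one, mul_zero]
  · rw [Finset.sum_comm]
    refine Finset.sum_congr rfl fun j _ => Finset.sum_congr rfl fun i _ => ?_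
    rw [mul_comm (w i)]

theorem socleCoeff_mulS_sum_G (hn : 1 ≤ n) (w : ℕ → K) :
    socleCoeff K (2 ^ n) (mulS K n (∑ i : Fin (2 ^ n), w i • G K (2 ^ n) i) : O K (2 ^ n)) =
      ∑ i ∈ Finset.range (2 ^ n), if i % 3 = (2 * 2 ^ n - 1) % 3 then w i else 0 := by
  rw [map_sum, AddSubmonoidClass.coe_finsetSum, map_sum, Finset.sum_range]
  refine Finset.sum_congr rfl fun i _ => ?_
  rw [map_smul, Submodule.coe_smul, map_smul, ← classW_repG, mulS_classW]
  have := socleCoeff_pair (K := K) hn i.2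
  rw [repG, this, smul_eq_mul, mul_ite, mul_one, mul_zero]

/-- The H_j are free of z while R involves only z and z², so a coefficient form at z-degree 1
isolates γ and forms at z-degree 0 isolate each H_j. -/
theorem eq_zero_of_smul_γ_add_sum_H (A : K) (hn : 1 ≤ n) {b : K} {m : Fin (2 ^ n) → K}
    (h : b • γ (2 ^ n) A + ∑ j, m j • H (2 ^ n) A j = 0) : b = 0 ∧ ∀ j, m j = 0 := by
  have h6 := two_pow_mod_six hn
  have h0 := Nat.one_le_two_pow (n := n)
  constructor
  · have := congrArg (remCoeffQuot A (2 * 2 ^ n - 1) (4 * 2 ^ n - 1) 1 (by omega) (by omega)) h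
    simp only [map_add, map_sum, map_smul, remCoeffQuot_H, one_ne_zero, and_false, if_false,
      add_zero, smul_zero, Finset.sum_const_zero, map_zero] at this
    rw [γ, remCoeffQuot_classW', remCoeff_γ (by omega)] at this
    simpa using this
  · intro k
    have hk := k.2
    have := congrArg (remCoeffQuot A (2 * 2 ^ n + 2 * k) (2 * 2 ^ n + (2 * 2 ^ n - 1 - 2 * k)) 0
      (by omega) (by omega)) h
    simp only [map_add, map_sum, map_smul, map_zero] at this
    rw [γ, remCoeffQuot_classW', remCoeff_γ_zero h0, smul_zero, zero_add,
      Finset.sum_eq_single k] at this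
    · rw [remCoeffQuot_H, if_pos ⟨rfl, rfl, rfl⟩, if_neg (by omega)] at this
      simpa using this
    · intro j _ hj
      have hj2 := j.2
      have hjk : (j : ℕ) ≠ k := fun h => hj (Fin.ext h)
      rw [remCoeffQuot_H, if_neg (by omega), if_neg (by omega)]
      simp
    · simp

/-- The map `X → Y ⊕ O_{12Q-3}` induced by `u ↦ (u g, u s)`. -/
def inducedMap (A : K) (hn : 1 ≤ n) :
    X K (2 ^ n) →ₗ[K] (Y (2 ^ n) A × component K (2 ^ n) (12 * 2 ^ n - 3)) :=
  ((mulG n A).restrict (p := X K (2 ^ n)) (q := Y (2 ^ n) A) (by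
    have : X K (2 ^ n) ≤ (Y (2 ^ n) A).comap (mulG n A) := by
      refine Submodule.span_le.mpr ?_
      rintro _ ⟨i, rfl⟩
      rw [SetLike.mem_coe, Submodule.mem_comap, mulG_G A i hn]
      refine add_mem (Submodule.smul_mem _ _ (Submodule.subset_span (Or.inr rfl)))
        (Submodule.sum_mem _ fun j _ =>
          Submodule.smul_mem _ _ (Submodule.subset_span (Or.inl ⟨j, rfl⟩)))
    exact fun _ hu => this hu)).prod ((mulS K n).comp (X K (2 ^ n)).subtype)

theorem isInducedMap_inducedMap (A : K) (hn : 1 ≤ n) : IsInducedMap A (inducedMap A hn) :=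
  fun u _ => ⟨⟨mul_pg_mem_W' A u.2, rfl⟩, rfl⟩

variable {A β : K} (hA : β ^ 2 + β = A) (hβ : β ^ 2 ^ (n + 1) = β)
  (hβ' : ∀ e < n, β ^ 2 ^ (e + 1) ≠ β) (hn : 1 ≤ n)

omit [NeZero (2 ^ n)] in
include hβ' in
theorem exists_specialEntry_coeff : ∃ c : ℕ → K, (∀ e, c e ≠ 0) ∧
    ∀ e < n, c e = β ^ 2 ^ (e + 1) + β := by
  refine ⟨fun e => if e < n then β ^ 2 ^ (e + 1) + β else 1, fun e => ?_, fun e he => if_pos he⟩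
  dsimp only
  split_ifs with he
  · exact fun h => hβ' e he (CharTwo.add_eq_zero.mp h)
  · exact one_ne_zero

include hA hβ hβ' hn in
theorem eq_zero_of_mulG_eq_zero_of_mulS_eq_zero (w : ℕ → K)
    (hG : mulG n A (∑ i : Fin (2 ^ n), w i • G K (2 ^ n) i) = 0)
    (hS : socleCoeff K (2 ^ n) (mulS K n (∑ i : Fin (2 ^ n), w i • G K (2 ^ n) i) :
      O K (2 ^ n)) = 0) : ∀ i < 2 ^ n, w i = 0 := by
  obtain ⟨c, hc, hcn⟩ := exists_specialEntry_coeff hβ'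
  rw [mulG_sum_G A hn] at hG
  obtain ⟨h1, h2⟩ := eq_zero_of_smul_γ_add_sum_H A hn hG
  rw [socleCoeff_mulS_sum_G hn] at hS
  refine specialEntry_trivial_kernel hc (two_pow_mod_six hn) (fun j hj => ?_) hS ?_
  · rw [← h2 ⟨j, hj⟩]
    refine Finset.sum_congr rfl fun i hi => ?_
    rw [multCoeff_eq_specialEntry hA hβ c hcn (Finset.mem_range.mp hi) hj]
  -- The γ-coefficient sums the `w i` with i ≢ 2Q-1 and the socle coefficient the others; together
  -- they give row C.
  · have := congrArg₂ (· + ·) h1 hS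
    simp only [← Finset.sum_add_distrib, add_zero] at this
    rw [← this]
    refine Finset.sum_congr rfl fun i _ => ?_
    split_ifs <;> simp

include hA hβ hβ' in
theorem inducedMap_injective : Function.Injective (inducedMap A hn) := by
  rw [← LinearMap.ker_eq_bot, LinearMap.ker_eq_bot']
  rintro ⟨u, hu⟩ h
  obtain ⟨v, rfl⟩ := (Submodule.mem_span_range_iff_exists_fun K).mp hu
  let w : ℕ → K := fun j => if hj : j < 2 ^ n then v ⟨j, hj⟩ else 0
  have hw : ∀ j : Fin (2 ^ n), v j = w j := fun j => by simp [w]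
  simp only [hw] at h ⊢
  have hG : mulG n A (∑ i : Fin (2 ^ n), w i • G K (2 ^ n) i) = 0 :=
    congrArg (fun z => (z.1 : W'Quot (2 ^ n) A)) h
  have hS : mulS K n (∑ i : Fin (2 ^ n), w i • G K (2 ^ n) i) = 0 := congrArg Prod.snd h
  have h0 := eq_zero_of_mulG_eq_zero_of_mulS_eq_zero hA hβ hβ' hn w hG (by rw [hS]; simp)
  apply Subtype.ext
  change ∑ i : Fin (2 ^ n), w i • G K (2 ^ n) i = 0
  exact Finset.sum_eq_zero fun i _ => by rw [h0 i i.2, zero_smul]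

include hA hβ hβ' hn in
theorem elemS_notMem_span :
    elemS K (2 ^ n) ∉ Ideal.span {toO K (2 ^ n) (pg A)} := by
  intro hs
  obtain ⟨h, hh⟩ := Ideal.mem_span_singleton'.mp hs
  obtain ⟨c, hc, hcn⟩ := exists_specialEntry_coeff hβ'
  -- The support in the residue class 2Q-1 also makes the γ-coefficient vanish.
  obtain ⟨w, ⟨i, hi, hwi⟩, hM, hBC⟩ := exists_specialEntry_kernel hc (two_pow_mod_six hn)
  have hG : mulG n A (∑ i : Fin (2 ^ n), w i • G K (2 ^ n) i) = 0 := by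
    rw [mulG_sum_G A hn, Finset.sum_eq_zero (s := Finset.range (2 ^ n)), zero_smul, zero_add]
    · refine Finset.sum_eq_zero fun j _ => ?_
      rw [← Finset.sum_congr (s₁ := Finset.range (2 ^ n)) rfl (fun i hi => by
        rw [multCoeff_eq_specialEntry hA hβ c hcn (Finset.mem_range.mp hi) j.2]), hM j j.2,
        zero_smul]
    · intro j _
      split_ifs with hj
      · rfl
      · exact hBC j hj
  refine hwi (eq_zero_of_mulG_eq_zero_of_mulS_eq_zero hA hβ hβ' hn w hG ?_ i hi)
  let u : W K (2 ^ n) := ∑ i : Fin (2 ^ n), w i • repG K (2 ^ n) i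
  have hu : ∑ i : Fin (2 ^ n), w i • G K (2 ^ n) i = classW u := by
    change _ = Submodule.mkQ _ u
    simp only [u, map_sum, map_smul]
    rfl
  rw [hu] at hG ⊢
  rw [mulG_classW] at hG
  obtain ⟨y, hy, hyu⟩ : (u : O K (2 ^ n)) * toO K (2 ^ n) (pg A) ∈ gW₀ (2 ^ n) A :=
    (Submodule.Quotient.mk_eq_zero ((gW₀ (2 ^ n) A).submoduleOf (W' K (2 ^ n)))).mp hG
  rw [LinearMap.mulLeft_apply] at hyu
  -- With s = hg and ug = gy for y in W₀: us = ugh = gyh = ys = 0.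
  rw [mulS_classW, ← hh, mul_comm h, ← mul_assoc, ← hyu, mul_comm (toO K (2 ^ n) (pg A)), mul_assoc,
    mul_comm (toO K (2 ^ n) (pg A)), hh, mul_elemS_eq_zero_of_mem_W₀ hy, map_zero]

include hA hβ hβ' hn in
theorem monomial_mul_pf_pow_notMem_span :
    px K * py K * pf K ^ 2 ^ n ∉ Ideal.span {px K ^ (4 * 2 ^ n), py K ^ (4 * 2 ^ n),
      pz K ^ (4 * 2 ^ n), pg A} := by
  intro h
  apply elemS_notMem_span hA hβ hβ' hn
  have h1 := Ideal.mem_map_of_mem (toO K (2 ^ n)) h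
  rw [Ideal.map_span] at h1
  refine Ideal.span_le.mpr ?_ h1
  rintro _ ⟨p, hp, rfl⟩
  rcases hp with rfl | rfl | rfl | rfl
  · rw [toO_eq_zero_of_dvd (Or.inl rfl) dvd_rfl]
    exact zero_mem _
  · rw [toO_eq_zero_of_dvd (Or.inr (Or.inl rfl)) dvd_rfl]
    exact zero_mem _
  · rw [toO_eq_zero_of_dvd (Or.inr (Or.inr rfl)) dvd_rfl]
    exact zero_mem _
  · exact Ideal.subset_span rfl

end InducedMap

end BrennerMonsky
end

theorem theorem3 {F : Type*} [Field F] [CharP F 2]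
    {K : Type*} [Field K] [Algebra (ZMod 2) K] [IsAlgClosure (ZMod 2) K] :
    -- the stacked matrix of a special `Q`-matrix has rank `Q`
    (∀ (Q : ℕ), (∃ n : ℕ, 1 ≤ n ∧ Q = 2 ^ n) →
      ∀ M : Matrix (Fin Q) (Fin Q) F, BrennerMonsky.IsSpecialMatrix M →
        (BrennerMonsky.stacked M).rank = Q) ∧
    -- the consequences for a nonzero `A = β² + β`, with `m` the degree of `β` over `ℤ/2`
    (∀ (A β : K), A ≠ 0 → β ^ 2 + β = A →
      ∀ (m Q : ℕ) [NeZero Q], m = (minpoly (ZMod 2) β).natDegree → Q = 2 ^ (m - 1) →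
        -- the map `X → Y ⊕ O_{12Q-3}`, `u ↦ (u g, u s)`, is well defined and injective
        (∃ Φ : BrennerMonsky.X K Q →ₗ[K]
            (BrennerMonsky.Y Q A × BrennerMonsky.component K Q (12 * Q - 3)),
          BrennerMonsky.IsInducedMap A Φ ∧ Function.Injective Φ) ∧
        -- `s ∉ g O`
        BrennerMonsky.elemS K Q ∉
          Ideal.span {BrennerMonsky.toO K Q (BrennerMonsky.pg A)} ∧
        -- `x y f^Q ∉ (x^{4Q}, y^{4Q}, z^{4Q}, g_A)`
        BrennerMonsky.px K * BrennerMonsky.py K * BrennerMonsky.pf K ^ Q ∉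
          Ideal.span {BrennerMonsky.px K ^ (4 * Q), BrennerMonsky.py K ^ (4 * Q),
            BrennerMonsky.pz K ^ (4 * Q), BrennerMonsky.pg A}) := by
  have : CharP K 2 := charP_of_injective_algebraMap (algebraMap (ZMod 2) K).injective 2
  refine ⟨?_, ?_⟩
  · rintro Q ⟨n, hn, rfl⟩ M hM
    exact BrennerMonsky.rank_stacked (BrennerMonsky.two_pow_mod_six hn) hM
  · intro A β hA0 hA m Q _ hm hQ
    subst hQ
    have hpow := BrennerMonsky.pow_two_pow_eq_self_iff β
    rw [← hm] at hpow
    -- Degree 1 would mean β² = β, that is A = 0. Hence Q ≥ 2.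
    have hm1 : m ≠ 1 := by
      rintro rfl
      have h := (hpow 1).mpr dvd_rfl
      rw [pow_one] at h
      rw [h, CharTwo.add_self_eq_zero] at hA
      exact hA0 hA.symm
    have hm0 : 0 < m := by
      rw [hm]
      exact minpoly.natDegree_pos
        ((IsAlgClosure.isAlgebraic (R := ZMod 2) (K := K)).isAlgebraic β).isIntegral
    have hn : 1 ≤ m - 1 := by omega
    have hβ : β ^ 2 ^ (m - 1 + 1) = β := (hpow _).mpr (by rw [Nat.sub_add_cancel hm0])
    have hβ' : ∀ e < m - 1, β ^ 2 ^ (e + 1) ≠ β := fun e he h => by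
      have := Nat.le_of_dvd (Nat.succ_pos e) ((hpow _).mp h)
      omega
    exact ⟨⟨BrennerMonsky.inducedMap A hn, BrennerMonsky.isInducedMap_inducedMap A hn,
      BrennerMonsky.inducedMap_injective hA hβ hβ' hn⟩,
      BrennerMonsky.elemS_notMem_span hA hβ hβ' hn,
      BrennerMonsky.monomial_mul_pf_pow_notMem_span hA hβ hβ' hn⟩
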